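/- Let $n \ge 0$ and let $\Omega_n = \mathbb{R}[x_1,\dots,x_n] \otimes \wedge\mathbb{R}^n$ be the algebra of polynomial differential forms on $\mathbb{R}^n$, generated by commuting $x_1,\dots,x_n$ and anticommuting $dx_1,\dots,dx_n$, where the $x_i$ commute with the $dx_j$. Let $S_n$ act on it by algebra automorphisms, $\sigma x_i = x_{\sigma(i)}$, $\sigma\,dx_i = dx_{\sigma(i)}$. Let $\Omega^{r,s}$ be the space of $s$-forms whose coefficients are homogeneous polynomials of degree $r$; total degree means $r+s$. Give $\Omega_n$ the tensor product of the usual inner product $\langle f,g\rangle = (f(\partial)g)(0)$ on $\mathbb{R}[x_1,\dots,x_n]$ (monomials are orthogonal and $\langle x^\alpha,x^\alpha\rangle=\alpha!$) and the inner product on $\wedge\mathbb{R}^n$ for which the $dx_{i_1}\wedge\cdots\wedge dx_{i_k}$, $i_1<\cdots<i_k$, are orthonormal. Let $\mathcal{H}$ be the orthogonal complement of the two-sided ideal of $\Omega_n$ generated by the $S_n$-invariants that are homogeneous of positive total degree, and let $H_{r,s} = \mathcal{H}\cap\Omega^{r,s}$. Then each $H_{r,s}$ is finite-dimensional, $\mathcal{H}=\bigoplus_{r,s\ge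 0}H_{r,s}$, and $$H_{r,s}=\{\omega\in\Omega^{r,s} : D_k\omega=0\ (1\le k\le n),\ \delta_l\omega=0\ (0\le l\le n-1)\},$$ where, for a polynomial $f$ and $dx_I=dx_{i_1}\wedge\cdots\wedge dx_{i_k}$, $D_k(f\,dx_I)=\sum_i(\partial_i^kf)\,dx_I$ and $\delta_l(f\,dx_I)=\sum_j(\partial_j^lf)\,\iota(dx_j)\,dx_I$, with $\iota(dx_j)$ the contraction. The bigraded Hilbert series of the alternants (the elements $\omega$ with $\sigma\omega=\operatorname{sgn}(\sigma)\,\omega$ for all $\sigma\in S_n$) in $\mathcal{H}$ is $$\sum_{r,s\ge 0} q^r t^s \dim\{\omega\in H_{r,s} : \sigma\omega=\operatorname{sgn}(\sigma)\,\omega\ \text{for all } \sigma\in S_n\}=\prod_{j=1}^{n-1}(q^j+t).$$ That is, if $\chi_{r,s}$ is the character of the representation of $S_n$ on $H_{r,s}$ and $(f,g)=\frac1{n!}\sum_{\sigma\in S_n}f(\sigma)g(\sigma)$, then $$\sum_{r,s\ge 0}q^rt^s\,(\chi_{r,s},\operatorname{sgn})=\prod_{j=1}^{n-1}(q^j+t).$$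 Both are identities of formal power series in $q$ and $t$. -/

import Mathlib

open scoped TensorProduct

noncomputable section

namespace PolyForms

/-- The polynomial ring `ℝ[x₁, …, xₙ]`. -/
abbrev Poly (n : ℕ) : Type := MvPolynomial (Fin n) ℝ

/-- The Grassmann algebra `⋀ ℝⁿ`, with `dxᵢ` the `i`-th standard basis vector of `ℝⁿ`. -/
abbrev Grass (n : ℕ) : Type := ExteriorAlgebra ℝ (Fin n → ℝ)

/-- The algebra `Ωₙ = ℝ[x₁, …, xₙ] ⊗ ⋀ ℝⁿ` of polynomial differential forms on `ℝⁿ`;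
the two tensor factors commute. -/
abbrev Form (n : ℕ) : Type := Poly n ⊗[ℝ] Grass n

/-- `Ω^{r,s}`: the `s`-forms whose coefficients are homogeneous polynomials of degree `r`. -/
def bidegree (n r s : ℕ) : Submodule ℝ (Form n) :=
  Submodule.map₂ (TensorProduct.mk ℝ (Poly n) (Grass n))
    (MvPolynomial.homogeneousSubmodule (Fin n) ℝ r) (⋀[ℝ]^s (Fin n → ℝ))

/-- The forms that are homogeneous of total degree `d`, where `deg xᵢ = deg dxᵢ = 1`. -/
def totalDegree (n d : ℕ) : Submodule ℝ (Form n) :=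
  ⨆ p : {p : ℕ × ℕ // p.1 + p.2 = d}, bidegree n p.1.1 p.1.2

/-! ### The action of the symmetric group -/

/-- The action of a permutation on `ℝⁿ`, `dxᵢ ↦ dx_{σ i}`. -/
def permVec (n : ℕ) (σ : Equiv.Perm (Fin n)) : (Fin n → ℝ) →ₗ[ℝ] (Fin n → ℝ) :=
  LinearMap.funLeft ℝ ℝ σ.symm

/-- The diagonal action of a permutation on `Ωₙ`: the algebra automorphism with
`xᵢ ↦ x_{σ i}` and `dxᵢ ↦ dx_{σ i}`. -/
def permAlg (n : ℕ) (σ : Equiv.Perm (Fin n)) : Form n →ₐ[ℝ] Form n :=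
  Algebra.TensorProduct.map (MvPolynomial.rename σ) (ExteriorAlgebra.map (permVec n σ))

theorem permVec_single (n : ℕ) (σ : Equiv.Perm (Fin n)) (i : Fin n) :
    permVec n σ (Pi.single i 1) = Pi.single (σ i) 1 := by
  ext j
  simp [permVec, LinearMap.funLeft_apply, Pi.single_apply, Equiv.symm_apply_eq]

theorem permVec_mul (n : ℕ) (σ τ : Equiv.Perm (Fin n)) :
    permVec n (σ * τ) = permVec n σ ∘ₗ permVec n τ := rfl

theorem permAlg_one (n : ℕ) : permAlg n 1 = AlgHom.id ℝ (Form n) := by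
  have h : permVec n 1 = LinearMap.id := rfl
  ext <;> simp [permAlg, h]

theorem permAlg_mul (n : ℕ) (σ τ : Equiv.Perm (Fin n)) :
    permAlg n (σ * τ) = (permAlg n σ).comp (permAlg n τ) := by
  ext <;> simp [permAlg, permVec_mul]

/-- The representation of `Sₙ` on `Ωₙ`. -/
def formRep (n : ℕ) : Representation ℝ (Equiv.Perm (Fin n)) (Form n) where
  toFun σ := (permAlg n σ).toLinearMap
  map_one' := by rw [permAlg_one]; rfl
  map_mul' σ τ := by rw [permAlg_mul]; rfl

/-- The forms on which every permutation acts by its sign. -/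
def signForms (n : ℕ) : Submodule ℝ (Form n) where
  carrier := {ω | ∀ σ, formRep n σ ω = ((Equiv.Perm.sign σ : ℤ) : ℝ) • ω}
  zero_mem' := by intro σ; simp
  add_mem' := by intro a b ha hb σ; rw [map_add, ha σ, hb σ, smul_add]
  smul_mem' := by intro c a ha σ; rw [map_smul, ha σ, smul_comm]

/-! ### The inner product -/

/-- The usual inner product `⟨f, g⟩ = (f(∂) g)(0)` on polynomials: distinct monomials are
orthogonal and `⟨x^α, x^α⟩ = α!`. -/
def polyInner (n : ℕ) : LinearMap.BilinForm ℝ (Poly n) :=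
  (MvPolynomial.basisMonomials (Fin n) ℝ).constr ℝ
    fun α => ((∏ i, (α i).factorial : ℕ) : ℝ) • MvPolynomial.lcoeff ℝ α

/-- The basis `dx_{i₁} ∧ ⋯ ∧ dx_{iₖ}`, `i₁ < ⋯ < iₖ`, of the Grassmann algebra. -/
def grassBasis (n : ℕ) : Module.Basis (Finset (Fin n)) ℝ (Grass n) :=
  (Pi.basisFun ℝ (Fin n)).ExteriorAlgebra

/-- The inner product on `⋀ ℝⁿ` for which the `dx_{i₁} ∧ ⋯ ∧ dx_{iₖ}`, `i₁ < ⋯ < iₖ`,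
form an orthonormal basis. -/
def grassInner (n : ℕ) : LinearMap.BilinForm ℝ (Grass n) :=
  (grassBasis n).toDual

/-- The tensor product inner product on `Ωₙ`. -/
def formInner (n : ℕ) : LinearMap.BilinForm ℝ (Form n) :=
  LinearMap.BilinForm.tmul (polyInner n) (grassInner n)

/-! ### Harmonic forms -/

/-- The two-sided ideal of `Ωₙ` generated by the `Sₙ`-invariant forms that are homogeneous of
positive total degree. -/
def invariantIdeal (n : ℕ) : TwoSidedIdeal (Form n) :=
  TwoSidedIdeal.span
    {ω | (∀ σ, formRep n σ ω = ω) ∧ ∃ d : ℕ, 0 < d ∧ ω ∈ totalDegree n d}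

/-- The harmonic forms: the orthogonal complement of the ideal of invariants. -/
def harmonicForms (n : ℕ) : Submodule ℝ (Form n) :=
  (formInner n).orthogonal ((invariantIdeal n).asIdeal.restrictScalars ℝ)

/-- `H_{r,s}`: the harmonic forms of bidegree `(r, s)`. -/
def harmonicPart (n r s : ℕ) : Submodule ℝ (Form n) :=
  harmonicForms n ⊓ bidegree n r s

/-- The alternants in `H_{r,s}`. -/
def alternants (n r s : ℕ) : Submodule ℝ (Form n) :=
  harmonicPart n r s ⊓ signForms n

/-! ### The differential operators cutting out the harmonic forms -/

/-- `∂ᵢˡ` on polynomials. -/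
def partialPow (n : ℕ) (i : Fin n) (l : ℕ) : Module.End ℝ (Poly n) :=
  ((MvPolynomial.pderiv i : Derivation ℝ (Poly n) (Poly n)) : Poly n →ₗ[ℝ] Poly n) ^ l

/-- The contraction `ι(dxᵢ)` on the Grassmann algebra. -/
def contract (n : ℕ) (i : Fin n) : Module.End ℝ (Grass n) :=
  CliffordAlgebra.contractLeft (LinearMap.proj i : Module.Dual ℝ (Fin n → ℝ))

/-- `D_l (f dx_I) = ∑ᵢ (∂ᵢˡ f) dx_I`. -/
def opD (n l : ℕ) : Module.End ℝ (Form n) :=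
  ∑ i : Fin n, TensorProduct.map (partialPow n i l) LinearMap.id

/-- `δ_l (f dx_I) = ∑ⱼ (∂ⱼˡ f) ι(dxⱼ) dx_I`. -/
def opDelta (n l : ℕ) : Module.End ℝ (Form n) :=
  ∑ j : Fin n, TensorProduct.map (partialPow n j l) (contract n j)

/-! ### `H_{r,s}` is a representation of `Sₙ` -/

theorem polyInner_monomial (n : ℕ) (α : Fin n →₀ ℕ) (g : Poly n) :
    polyInner n (MvPolynomial.monomial α 1) g =
      ((∏ i, (α i).factorial : ℕ) : ℝ) * MvPolynomial.coeff α g := by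
  have h := (MvPolynomial.basisMonomials (Fin n) ℝ).constr_basis ℝ
    (fun α => ((∏ i, (α i).factorial : ℕ) : ℝ) • MvPolynomial.lcoeff ℝ α) α
  rw [MvPolynomial.coe_basisMonomials] at h
  rw [polyInner, h]
  rfl

theorem polyInner_rename (n : ℕ) (σ : Equiv.Perm (Fin n)) (f g : Poly n) :
    polyInner n (MvPolynomial.rename σ f) (MvPolynomial.rename σ g) = polyInner n f g := by
  have key : (polyInner n).compl₁₂ (MvPolynomial.rename σ).toLinearMap
      (MvPolynomial.rename σ).toLinearMap = polyInner n := by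
    refine (MvPolynomial.basisMonomials (Fin n) ℝ).ext fun α => LinearMap.ext fun g => ?_
    simp only [MvPolynomial.coe_basisMonomials, LinearMap.compl₁₂_apply,
      AlgHom.toLinearMap_apply, MvPolynomial.rename_monomial, polyInner_monomial,
      MvPolynomial.coeff_rename_mapDomain _ σ.injective]
    congr 2
    rw [← Equiv.prod_comp σ]
    refine Finset.prod_congr rfl fun i _ => ?_
    rw [Finsupp.mapDomain_apply σ.injective]
  exact LinearMap.congr_fun₂ key f g

theorem map_grassBasis (n : ℕ) (σ : Equiv.Perm (Fin n)) (s : Finset (Fin n)) :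
    ∃ e : ℝ, e * e = 1 ∧ ExteriorAlgebra.map (permVec n σ) (grassBasis n s) =
      e • grassBasis n (s.map σ.toEmbedding) := by
  have hc : (s.map σ.toEmbedding).card = s.card := Finset.card_map _
  set a : Fin s.card → Fin n := fun k => s.orderEmbOfFin rfl k with ha
  set b : Fin s.card → Fin n := fun k => (s.map σ.toEmbedding).orderEmbOfFin hc k with hb
  have e1 : grassBasis n s = ExteriorAlgebra.ιMulti ℝ s.card
      ((Pi.basisFun ℝ (Fin n)) ∘ a) := by
    rw [grassBasis, ExteriorAlgebra.basis_apply_ofCard _ rfl]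
    rfl
  have e2 : grassBasis n (s.map σ.toEmbedding) = ExteriorAlgebra.ιMulti ℝ s.card
      ((Pi.basisFun ℝ (Fin n)) ∘ b) := by
    rw [grassBasis, ExteriorAlgebra.basis_apply_ofCard _ hc]
    rfl
  have hmem : ∀ k, ∃ l, b l = σ (a k) := by
    intro k
    have : σ (a k) ∈ Set.range b := by
      rw [hb]
      rw [Finset.range_orderEmbOfFin]
      simp [ha]
    exact this
  choose t ht using hmem
  have tinj : Function.Injective t := by
    intro x y hxy
    have : σ (a x) = σ (a y) := by rw [← ht, ← ht, hxy]
    exact (s.orderEmbOfFin rfl).injective (σ.injective this)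
  let τ : Equiv.Perm (Fin s.card) := Equiv.ofBijective t (Finite.injective_iff_bijective.mp tinj)
  refine ⟨((Equiv.Perm.sign τ : ℤ) : ℝ), ?_, ?_⟩
  · norm_cast
    simp
  · rw [e1, e2, ExteriorAlgebra.map_apply_ιMulti]
    have : (permVec n σ) ∘ (Pi.basisFun ℝ (Fin n)) ∘ a =
        ((Pi.basisFun ℝ (Fin n)) ∘ b) ∘ τ := by
      funext k
      simp only [Function.comp_apply, Pi.basisFun_apply, permVec_single]
      exact congrArg (fun j => Pi.single j (1 : ℝ)) (ht k).symm
    rw [this, AlternatingMap.map_perm, Int.cast_smul_eq_zsmul]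
    rfl

theorem grassInner_map (n : ℕ) (σ : Equiv.Perm (Fin n)) (x y : Grass n) :
    grassInner n (ExteriorAlgebra.map (permVec n σ) x) (ExteriorAlgebra.map (permVec n σ) y) =
      grassInner n x y := by
  have key : (grassInner n).compl₁₂ (ExteriorAlgebra.map (permVec n σ)).toLinearMap
      (ExteriorAlgebra.map (permVec n σ)).toLinearMap = grassInner n := by
    refine (grassBasis n).ext fun s => (grassBasis n).ext fun t => ?_
    obtain ⟨e, he, h1⟩ := map_grassBasis n σ s
    obtain ⟨f, hf, h2⟩ := map_grassBasis n σ t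
    simp only [LinearMap.compl₁₂_apply, AlgHom.toLinearMap_apply, h1, h2, map_smul,
      LinearMap.smul_apply, grassInner, Module.Basis.toDual_apply, Finset.map_inj, smul_eq_mul]
    split_ifs with hst
    · subst hst
      rw [h1] at h2
      have := congrArg (fun z => (grassBasis n).repr z (s.map σ.toEmbedding)) h2
      simp at this
      rw [this] at he ⊢
      simpa using hf
    · simp
  exact LinearMap.congr_fun₂ key x y

theorem formInner_formRep (n : ℕ) (σ : Equiv.Perm (Fin n)) (x y : Form n) :
    formInner n (formRep n σ x) (formRep n σ y) = formInner n x y := by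
  have key : (formInner n).compl₁₂ (formRep n σ) (formRep n σ) = formInner n := by
    apply TensorProduct.ext'
    intro f u
    apply TensorProduct.ext'
    intro g v
    change formInner n (MvPolynomial.rename σ f ⊗ₜ ExteriorAlgebra.map (permVec n σ) u)
      (MvPolynomial.rename σ g ⊗ₜ ExteriorAlgebra.map (permVec n σ) v) = _
    simp [formInner, polyInner_rename, grassInner_map]
  exact LinearMap.congr_fun₂ key x y

theorem bidegree_formRep (n r s : ℕ) (σ : Equiv.Perm (Fin n)) :
    bidegree n r s ≤ (bidegree n r s).comap (formRep n σ) := by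
  rw [bidegree, Submodule.map₂_le]
  intro f hf u hu
  change TensorProduct.mk ℝ (Poly n) (Grass n) (MvPolynomial.rename σ f)
    (ExteriorAlgebra.map (permVec n σ) u) ∈ bidegree n r s
  refine Submodule.apply_mem_map₂ (TensorProduct.mk ℝ (Poly n) (Grass n)) ?_ ?_
  · rw [MvPolynomial.mem_homogeneousSubmodule] at hf ⊢
    exact hf.rename_isHomogeneous
  · rw [← exteriorPower.ιMulti_span_fixedDegree ℝ s (Fin n → ℝ)] at hu ⊢
    induction hu using Submodule.span_induction with
    | mem x hx =>
      obtain ⟨v, rfl⟩ := hx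
      rw [ExteriorAlgebra.map_apply_ιMulti]
      exact Submodule.subset_span ⟨_, rfl⟩
    | zero => simp
    | add x y _ _ hx hy => rw [map_add]; exact add_mem hx hy
    | smul c x _ hx => rw [map_smul]; exact Submodule.smul_mem _ _ hx

theorem totalDegree_formRep (n d : ℕ) (σ : Equiv.Perm (Fin n)) :
    totalDegree n d ≤ (totalDegree n d).comap (formRep n σ) :=
  iSup_le fun p => (bidegree_formRep n p.1.1 p.1.2 σ).trans
    (Submodule.comap_mono (le_iSup (fun p : {p : ℕ × ℕ // p.1 + p.2 = d} =>
      bidegree n p.1.1 p.1.2) p))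

theorem invariantIdeal_formRep (n : ℕ) (σ : Equiv.Perm (Fin n)) {ω : Form n}
    (h : ω ∈ invariantIdeal n) : formRep n σ ω ∈ invariantIdeal n := by
  have : invariantIdeal n ≤ (invariantIdeal n).comap (permAlg n σ) := by
    rw [invariantIdeal, TwoSidedIdeal.span_le]
    intro η hη
    rw [SetLike.mem_coe, TwoSidedIdeal.mem_comap]
    have : permAlg n σ η = η := hη.1 σ
    rw [this]
    exact TwoSidedIdeal.subset_span hη
  exact (TwoSidedIdeal.mem_comap (permAlg n σ)).mp (this h)

theorem harmonicForms_formRep (n : ℕ) (σ : Equiv.Perm (Fin n)) :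
    harmonicForms n ≤ (harmonicForms n).comap (formRep n σ) := by
  intro ω hω
  rw [Submodule.mem_comap, harmonicForms, LinearMap.BilinForm.mem_orthogonal_iff]
  rw [harmonicForms, LinearMap.BilinForm.mem_orthogonal_iff] at hω
  intro η hη
  have h1 : η = formRep n σ (formRep n σ⁻¹ η) := by
    rw [← Module.End.mul_apply, ← map_mul, mul_inv_cancel, map_one, Module.End.one_apply]
  rw [h1, formInner_formRep]
  exact hω _ (invariantIdeal_formRep n σ⁻¹ hη)

theorem harmonicPart_formRep (n r s : ℕ) (σ : Equiv.Perm (Fin n)) :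
    harmonicPart n r s ≤ (harmonicPart n r s).comap (formRep n σ) := fun _ h =>
  ⟨harmonicForms_formRep n σ h.1, bidegree_formRep n r s σ h.2⟩

/-- The representation of `Sₙ` on `H_{r,s}`. -/
def harmonicRep (n r s : ℕ) : Representation ℝ (Equiv.Perm (Fin n)) (harmonicPart n r s) :=
  (formRep n).subrepresentation (harmonicPart n r s) (harmonicPart_formRep n r s)

/-- The character `χ_{r,s}` of `H_{r,s}`. -/
def harmonicChar (n r s : ℕ) (σ : Equiv.Perm (Fin n)) : ℝ :=
  LinearMap.trace ℝ (harmonicPart n r s) (harmonicRep n r s σ)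

/-! ### Hilbert series -/

/-- The inner product `(f, g) = (1/n!) ∑_σ f(σ) g(σ)` of real functions on `Sₙ`. -/
def classInner (n : ℕ) (f g : Equiv.Perm (Fin n) → ℝ) : ℝ :=
  (1 / (n.factorial : ℝ)) * ∑ σ, f σ * g σ

/-- The sign character of `Sₙ`. -/
def sgn (n : ℕ) (σ : Equiv.Perm (Fin n)) : ℝ := ((Equiv.Perm.sign σ : ℤ) : ℝ)

/-- `∑_{r,s} (dim of the alternants in H_{r,s}) q^r t^s`, with `q = X 0` and `t = X 1`. -/
def alternantSeries (n : ℕ) : MvPowerSeries (Fin 2) ℝ :=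
  fun d => (Module.finrank ℝ (alternants n (d 0) (d 1)) : ℝ)

/-- `∑_{r,s} (χ_{r,s}, sgn) q^r t^s`, where `χ_{r,s}` is the character of `H_{r,s}`. -/
def characterSeries (n : ℕ) : MvPowerSeries (Fin 2) ℝ :=
  fun d => classInner n (harmonicChar n (d 0) (d 1)) (sgn n)

end PolyForms

end

/-!
The proof rests on two families of odd operators. The operators `d_l = ∑ⱼ ∂ⱼˡ dxⱼ` anticommute, as
do their adjoints, the contractions with the invariant vector fields `∑ⱼ xⱼˡ ∂ⱼ`
(`formInner_opd`). Hence each family makes the forms a module over the Grassmann algebra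
(`opdHom`, `fieldHom`), and for `S ⊆ {0, …, n-1}` there are composites `opdOp S` and `fieldOp S`,
determined up to sign.

*Harmonic forms.* Symmetrizing forms, by induction on the number of variables that they involve,
shows that the ideal of invariants is generated by the power sums and the forms `∑ⱼ xⱼˡ dxⱼ`
(`mem_invariantIdeal_iff`); by Newton's identities those with `k ≤ n` and `l < n` suffice. The
adjoints of multiplication by these generators are `D_k` and `δ_l`, so that these operators cut out
the harmonic forms (`harmonic_of_operators`). The operators are bihomogeneous, which gives the
decomposition into the `H_{r,s}` (`iSup_harmonicPart`).

*The fundamental alternant.* Contracting the volume form with all `n` invariant vector fields gives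
`topAlternant n`, a nonzero multiple of the Vandermonde determinant. It is harmonic, and
alternating functions are its multiples by symmetric polynomials.

*Lower bound.* The Cartan formula `δ_k d_l + d_l δ_k = D_{k+l}` shows that `d_l`, `l ≥ 1`,
preserves harmonic forms. So the forms `opdOp S (topAlternant n)`, `S ⊆ {1, …, n-1}`, are harmonic
alternants. They are linearly independent: applying `opdOp Sᶜ` kills all of them of the same degree
except the one for `S`, and `opdOp univ (topAlternant n)` is nonzero as it pairs with the volume
form to the norm of `topAlternant n`, up to sign.

*Upper bound.* The invariant vector fields form a basis over the rational functions, by the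
Vandermonde determinant. So an alternating `s`-form `ω` is determined by the alternating functions
`fieldOp S ω = g_S • topAlternant n`, `|S| = s`, and `ω = ∑_S ± g_S • fieldOp Sᶜ (volumeForm n)`
with symmetric `g_S` (`exists_expansion`). If `ω` is harmonic and every `g_S` has constant term
zero, then `ω` lies in the ideal of invariants and is orthogonal to itself, hence zero. The constant
term of `g_S` vanishes for degree reasons unless `∑_{i ∉ S} i = r`, and it vanishes if `0 ∈ S`, as
contraction with `∑ⱼ ∂ⱼ` is `δ_0`. So the dimension is at most the number of remaining `S`
(`finrank_alternants_le`).

The sets `S ⊆ {1, …, n-1}` with `|S| = s` and `∑_{i ∉ S} i = r` are counted by the coefficient of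
`q^r t^s` in `∏ (q^j + t)` (`card_alternantIndex`). The multiplicity of the sign character is the
trace of the projection onto the alternants.
-/

noncomputable section

namespace PolyForms


/-! ### The standard basis of the Grassmann algebra -/

/-- The generator `dxᵢ` of the Grassmann algebra, for `i : Fin n`. -/
def dx (n : ℕ) (i : Fin n) : Grass n := ExteriorAlgebra.ι ℝ (Pi.single i 1)

/-- The sign `e` is that of a shuffle; only `e * e = 1` matters in what follows. -/
theorem grassBasis_mul_of_disjoint {n : ℕ} {S T : Finset (Fin n)} (h : Disjoint S T) :
    ∃ e : ℝ, e * e = 1 ∧ grassBasis n S * grassBasis n T = e • grassBasis n (S ∪ T) := by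
  have := ExteriorAlgebra.basis_mul_of_disjoint (Pi.basisFun ℝ (Fin n))
    (Set.powersetCard.ofCard (s := S) rfl) (Set.powersetCard.ofCard (s := T) rfl) h
  refine ⟨((Equiv.Perm.sign (Set.powersetCard.permOfDisjoint
    (s := Set.powersetCard.ofCard (s := S) rfl) (t := Set.powersetCard.ofCard (s := T) rfl) h) : ℤ)
      : ℝ), ?_, ?_⟩
  · norm_cast
    simp
  · rw [Int.cast_smul_eq_zsmul, ← Units.smul_def]
    rw [← Finset.disjUnion_eq_union _ _ h]
    exact this

theorem grassBasis_mul_of_not_disjoint {n : ℕ} {S T : Finset (Fin n)} (h : ¬ Disjoint S T) :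
    grassBasis n S * grassBasis n T = 0 :=
  ExteriorAlgebra.basis_mul_of_not_disjoint (Pi.basisFun ℝ (Fin n))
    (Set.powersetCard.ofCard (s := S) rfl) (Set.powersetCard.ofCard (s := T) rfl) h

theorem grassBasis_singleton {n : ℕ} (i : Fin n) : grassBasis n {i} = dx n i := by
  rw [grassBasis, ExteriorAlgebra.basis_apply_ofCard _ (Finset.card_singleton i)]
  have h (k : Fin 1) : Set.powersetCard.ofFinEmbEquiv.symm
      (Set.powersetCard.ofCard (Finset.card_singleton i)) k = i := by
    have := Finset.orderEmbOfFin_mem {i} (Finset.card_singleton i) k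
    rwa [Finset.mem_singleton] at this
  simp only [ExteriorAlgebra.ιMulti_family, ExteriorAlgebra.ιMulti_apply, dx]
  simp [h]

theorem grassBasis_empty {n : ℕ} : grassBasis n ∅ = 1 := by
  rw [grassBasis, ExteriorAlgebra.basis_apply_ofCard _ Finset.card_empty]
  simp [ExteriorAlgebra.ιMulti_family]

theorem dx_mul_grassBasis {n : ℕ} {i : Fin n} {S : Finset (Fin n)} (h : i ∉ S) :
    ∃ e : ℝ, e * e = 1 ∧ dx n i * grassBasis n S = e • grassBasis n (insert i S) := by
  rw [← grassBasis_singleton, Finset.insert_eq]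
  exact grassBasis_mul_of_disjoint (by simpa using h)

theorem dx_mul_grassBasis_of_mem {n : ℕ} {i : Fin n} {S : Finset (Fin n)} (h : i ∈ S) :
    dx n i * grassBasis n S = 0 := by
  rw [← grassBasis_singleton]
  exact grassBasis_mul_of_not_disjoint (by simpa using h)

theorem eq_smul_of_eq_smul {M : Type*} [AddCommGroup M] [Module ℝ M] {x y : M} {e : ℝ}
    (he : e * e = 1) (h : x = e • y) : y = e • x := by
  rw [h, smul_smul, he, one_smul]

theorem dx_mul_dx_add {n : ℕ} (i j : Fin n) : dx n i * dx n j + dx n j * dx n i = 0 :=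
  ExteriorAlgebra.ι_add_mul_swap _ _

/-! ### Contraction -/

theorem contract_dx_mul {n : ℕ} (i j : Fin n) (u : Grass n) :
    contract n i (dx n j * u) = (if i = j then u else 0) - dx n j * contract n i u := by
  have := CliffordAlgebra.contractLeft_ι_mul (Q := (0 : QuadraticForm ℝ (Fin n → ℝ)))
    (LinearMap.proj i : Module.Dual ℝ (Fin n → ℝ)) (Pi.single j 1) u
  rw [contract, dx]
  refine this.trans ?_
  congr 1
  simp [Pi.single_apply]

theorem contract_one {n : ℕ} (i : Fin n) : contract n i 1 = 0 :=
  CliffordAlgebra.contractLeft_one (Q := (0 : QuadraticForm ℝ (Fin n → ℝ))) _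

/-- The anticommutator of a multiplication and a contraction is a scalar. -/
theorem contract_dx_anticomm {n : ℕ} (i j : Fin n) :
    contract n i * LinearMap.mulLeft ℝ (dx n j) + LinearMap.mulLeft ℝ (dx n j) * contract n i =
      if i = j then 1 else 0 := by
  refine LinearMap.ext fun u => ?_
  simp only [LinearMap.add_apply, Module.End.mul_apply, LinearMap.mulLeft_apply, contract_dx_mul]
  split_ifs <;> simp

theorem contract_anticomm {n : ℕ} (i j : Fin n) :
    contract n i * contract n j + contract n j * contract n i = 0 := by
  refine LinearMap.ext fun u => ?_
  simp only [LinearMap.add_apply, Module.End.mul_apply]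
  rw [contract, contract, CliffordAlgebra.contractLeft_comm]
  simp

theorem contract_grassBasis {n : ℕ} {i : Fin n} {S : Finset (Fin n)} (h : i ∉ S) :
    contract n i (grassBasis n S) = 0 := by
  induction S using Finset.induction with
  | empty => rw [grassBasis_empty, contract_one]
  | insert j S hj ih =>
    obtain ⟨e, he, h1⟩ := dx_mul_grassBasis hj
    rw [eq_smul_of_eq_smul he h1, map_smul, contract_dx_mul, ih fun h' => h (by simp [h'])]
    have : i ≠ j := by rintro rfl; simp at h
    simp [this]

theorem contract_map {n : ℕ} (σ : Equiv.Perm (Fin n)) (i : Fin n) (u : Grass n) :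
    ExteriorAlgebra.map (permVec n σ) (contract n i u) =
      contract n (σ i) (ExteriorAlgebra.map (permVec n σ) u) := by
  induction u using CliffordAlgebra.left_induction with
  | algebraMap r =>
    rw [contract, CliffordAlgebra.contractLeft_algebraMap, map_zero]
    erw [AlgHom.commutes]
    rw [contract]
    exact (CliffordAlgebra.contractLeft_algebraMap (0 : QuadraticForm ℝ (Fin n → ℝ)) _ _).symm
  | add x y hx hy => simp only [map_add, hx, hy]
  | ι_mul x v hx =>
    have key : ∀ (k : Fin n) (w : Fin n → ℝ) (y : Grass n),
        contract n k (ExteriorAlgebra.ι ℝ w * y) =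
          w k • y - ExteriorAlgebra.ι ℝ w * contract n k y := fun k w y =>
      CliffordAlgebra.contractLeft_ι_mul (Q := (0 : QuadraticForm ℝ (Fin n → ℝ)))
        (LinearMap.proj k : Module.Dual ℝ (Fin n → ℝ)) w y
    change ExteriorAlgebra.map (permVec n σ) (contract n i (ExteriorAlgebra.ι ℝ v * x)) =
      contract n (σ i) (ExteriorAlgebra.map (permVec n σ) (ExteriorAlgebra.ι ℝ v * x))
    rw [key, map_mul, ExteriorAlgebra.map_apply_ι, key, map_sub, map_smul, map_mul,
      ExteriorAlgebra.map_apply_ι, hx]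
    simp [permVec, LinearMap.funLeft_apply]

theorem grassInner_grassBasis {n : ℕ} (S T : Finset (Fin n)) :
    grassInner n (grassBasis n S) (grassBasis n T) = if S = T then 1 else 0 := by
  rw [grassInner, Module.Basis.toDual_apply]

/-- Contraction with `dx_i` is adjoint to multiplication by `dx_i`. -/
theorem grassInner_dx_mul {n : ℕ} (i : Fin n) (u v : Grass n) :
    grassInner n (dx n i * u) v = grassInner n u (contract n i v) := by
  have key : (grassInner n).compl₁₂ (LinearMap.mulLeft ℝ (dx n i)) LinearMap.id =
      (grassInner n).compl₁₂ LinearMap.id (contract n i) := by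
    refine (grassBasis n).ext fun S => (grassBasis n).ext fun T => ?_
    simp only [LinearMap.compl₁₂_apply, LinearMap.mulLeft_apply, LinearMap.id_apply]
    by_cases hT : i ∈ T
    · obtain ⟨e, he, h1⟩ := dx_mul_grassBasis (Finset.notMem_erase i T)
      rw [Finset.insert_erase hT] at h1
      have h2 : contract n i (grassBasis n T) = e • grassBasis n (T.erase i) := by
        rw [eq_smul_of_eq_smul he h1, map_smul, contract_dx_mul,
          contract_grassBasis (Finset.notMem_erase i T)]
        simp
      rw [h2, map_smul, grassInner_grassBasis]
      by_cases hS : i ∈ S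
      · rw [dx_mul_grassBasis_of_mem hS, if_neg]
        · simp
        · rintro rfl
          simp at hS
      · by_cases hST : S = T.erase i
        · rw [if_pos hST, hST, h1, map_smul, LinearMap.smul_apply, grassInner_grassBasis,
            if_pos rfl]
        · obtain ⟨f, hf, h3⟩ := dx_mul_grassBasis hS
          rw [if_neg hST, h3, map_smul, LinearMap.smul_apply, grassInner_grassBasis, if_neg]
          · simp
          · rintro rfl
            simp [hS] at hST
    · rw [contract_grassBasis hT, map_zero]
      by_cases hS : i ∈ S
      · rw [dx_mul_grassBasis_of_mem hS]
        simp
      · obtain ⟨f, hf, h3⟩ := dx_mul_grassBasis hS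
        rw [h3, map_smul, LinearMap.smul_apply, grassInner_grassBasis, if_neg]
        · simp
        · rintro rfl
          simp at hT
  exact LinearMap.congr_fun₂ key u v

theorem grassBasis_mem {n : ℕ} (S : Finset (Fin n)) : grassBasis n S ∈ ⋀[ℝ]^S.card (Fin n → ℝ) := by
  rw [grassBasis, ExteriorAlgebra.basis_apply_ofCard _ rfl,
    ← ExteriorAlgebra.ιMulti_span_fixedDegree]
  exact Submodule.subset_span ⟨_, rfl⟩

theorem dx_mul_mem {n s : ℕ} (i : Fin n) {u : Grass n} (hu : u ∈ ⋀[ℝ]^s (Fin n → ℝ)) :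
    dx n i * u ∈ ⋀[ℝ]^(s + 1) (Fin n → ℝ) := by
  rw [ExteriorAlgebra.exteriorPower, pow_succ']
  exact Submodule.mul_mem_mul ⟨_, rfl⟩ hu

/-- Homogeneous elements of positive degree are sums of multiples of the `dx_i`. -/
theorem exteriorPower_succ_induction {n s : ℕ} {C : Grass n → Prop}
    (mul : ∀ i, ∀ u ∈ ⋀[ℝ]^s (Fin n → ℝ), C (dx n i * u)) (zero : C 0)
    (add : ∀ x y, C x → C y → C (x + y)) {u : Grass n} (hu : u ∈ ⋀[ℝ]^(s + 1) (Fin n → ℝ)) :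
    C u := by
  rw [ExteriorAlgebra.exteriorPower, pow_succ'] at hu
  induction hu using Submodule.mul_induction_on' with
  | mem_mul_mem x hx y hy =>
    obtain ⟨v, rfl⟩ := hx
    have : v = ∑ i, v i • (Pi.single i 1 : Fin n → ℝ) := by
      ext j
      simp [Finset.sum_apply, Pi.single_apply]
    rw [this, map_sum, Finset.sum_mul]
    refine Finset.sum_induction _ C add zero fun i _ => ?_
    rw [map_smul, smul_mul_assoc, ← mul_smul_comm]
    exact mul i _ (Submodule.smul_mem _ _ hy)
  | add x _ y _ hx hy => exact add x y hx hy

theorem contract_mem_zero {n : ℕ} (i : Fin n) {u : Grass n} (hu : u ∈ ⋀[ℝ]^0 (Fin n → ℝ)) :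
    contract n i u = 0 := by
  rw [ExteriorAlgebra.exteriorPower, pow_zero, Submodule.mem_one] at hu
  obtain ⟨c, rfl⟩ := hu
  exact CliffordAlgebra.contractLeft_algebraMap (0 : QuadraticForm ℝ (Fin n → ℝ)) _ _

theorem contract_mem {n : ℕ} (i : Fin n) : ∀ {s : ℕ} {u : Grass n},
    u ∈ ⋀[ℝ]^(s + 1) (Fin n → ℝ) → contract n i u ∈ ⋀[ℝ]^s (Fin n → ℝ)
  | s, u, hu => by
    refine exteriorPower_succ_induction (C := fun u => contract n i u ∈ ⋀[ℝ]^s (Fin n → ℝ))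
      (fun j v hv => ?_) (by simp) (fun x y hx hy => by rw [map_add]; exact add_mem hx hy) hu
    rw [contract_dx_mul]
    refine sub_mem ?_ ?_
    · split_ifs
      · exact hv
      · exact zero_mem _
    · cases s with
      | zero => rw [contract_mem_zero i hv, mul_zero]; exact zero_mem _
      | succ s => exact dx_mul_mem j (contract_mem i hv)

/-- Right and left multiplication by `dxᵢ` agree up to the sign of the degree. -/
theorem mul_dx {n : ℕ} (u : Grass n) (i : Fin n) :
    u * dx n i = dx n i * CliffordAlgebra.involute u := by
  induction u using CliffordAlgebra.left_induction with
  | algebraMap r =>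
    rw [AlgHom.commutes]
    exact Algebra.commutes _ _
  | add x y hx hy => rw [add_mul, hx, hy, map_add, mul_add]
  | ι_mul x v hx =>
    rw [map_mul, CliffordAlgebra.involute_ι, mul_assoc, hx, ← mul_assoc]
    have := ExteriorAlgebra.ι_add_mul_swap (R := ℝ) v (Pi.single i (1 : ℝ))
    rw [add_eq_zero_iff_eq_neg] at this
    rw [dx]
    erw [this, neg_mul, neg_mul, mul_neg, mul_assoc]

theorem map_dx {n : ℕ} (σ : Equiv.Perm (Fin n)) (i : Fin n) :
    ExteriorAlgebra.map (permVec n σ) (dx n i) = dx n (σ i) := by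
  rw [dx, ExteriorAlgebra.map_apply_ι, permVec_single, dx]

/-- The top form `dx_1 ∧ ⋯ ∧ dx_n` spans a copy of the sign representation. -/
theorem map_grassBasis_univ {n : ℕ} (σ : Equiv.Perm (Fin n)) :
    ExteriorAlgebra.map (permVec n σ) (grassBasis n Finset.univ) =
      ((Equiv.Perm.sign σ : ℤ) : ℝ) • grassBasis n Finset.univ := by
  have e : grassBasis n Finset.univ = ExteriorAlgebra.ιMulti ℝ n (Pi.basisFun ℝ (Fin n)) := by
    rw [grassBasis, ExteriorAlgebra.basis_apply_ofCard _ (Finset.card_fin n)]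
    rw [ExteriorAlgebra.ιMulti_family]
    congr 1
    funext k
    have : (Finset.univ : Finset (Fin n)).orderEmbOfFin (Finset.card_fin n) =
        (OrderIso.refl (Fin n)).toOrderEmbedding :=
      (Finset.orderEmbOfFin_unique' _ fun _ => Finset.mem_univ _).symm
    have h2 := congrArg (fun f : Fin n ↪o Fin n => f k) this
    simp only [Function.comp_apply]
    exact congrArg _ h2
  rw [e, ExteriorAlgebra.map_apply_ιMulti]
  have : (permVec n σ) ∘ (Pi.basisFun ℝ (Fin n)) = (Pi.basisFun ℝ (Fin n)) ∘ σ := by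
    funext k
    simp [Pi.basisFun_apply, permVec_single]
  rw [this, AlternatingMap.map_perm, Int.cast_smul_eq_zsmul]
  rfl


/-! ### The inner product -/

theorem polyInner_monomial_monomial {n : ℕ} (α β : Fin n →₀ ℕ) :
    polyInner n (MvPolynomial.monomial α 1) (MvPolynomial.monomial β 1) =
      if α = β then ((∏ i, (α i).factorial : ℕ) : ℝ) else 0 := by
  rw [polyInner_monomial, MvPolynomial.coeff_monomial]
  split_ifs with h1 h2 h2 <;> simp_all

theorem polyInner_comm {n : ℕ} (f g : Poly n) : polyInner n f g = polyInner n g f := by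
  have key : polyInner n = LinearMap.flip (polyInner n) := by
    refine (MvPolynomial.basisMonomials (Fin n) ℝ).ext fun α =>
      (MvPolynomial.basisMonomials (Fin n) ℝ).ext fun β => ?_
    simp only [MvPolynomial.coe_basisMonomials, LinearMap.flip_apply, polyInner_monomial_monomial]
    split_ifs with h1 h2 h2
    · rw [h1]
    · exact absurd h1.symm h2
    · exact absurd h2.symm h1
    · rfl
  exact LinearMap.congr_fun₂ key f g

theorem grassInner_comm {n : ℕ} (u v : Grass n) : grassInner n u v = grassInner n v u := by
  have key : grassInner n = LinearMap.flip (grassInner n) := by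
    refine (grassBasis n).ext fun S => (grassBasis n).ext fun T => ?_
    simp only [LinearMap.flip_apply, grassInner_grassBasis]
    exact if_congr (eq_comm (a := S) (b := T)) rfl rfl
  exact LinearMap.congr_fun₂ key u v

theorem polyInner_X_mul {n : ℕ} (i : Fin n) (f g : Poly n) :
    polyInner n (MvPolynomial.X i * f) g = polyInner n f (MvPolynomial.pderiv i g) := by
  have key : (polyInner n).compl₁₂ (LinearMap.mulLeft ℝ (MvPolynomial.X i)) LinearMap.id =
      (polyInner n).compl₁₂ LinearMap.id
        ((MvPolynomial.pderiv i : Derivation ℝ (Poly n) (Poly n)) : Poly n →ₗ[ℝ] Poly n) := by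
    refine (MvPolynomial.basisMonomials (Fin n) ℝ).ext fun α => LinearMap.ext fun g => ?_
    simp only [MvPolynomial.coe_basisMonomials, LinearMap.compl₁₂_apply, LinearMap.mulLeft_apply,
      LinearMap.id_apply, Derivation.coeFn_coe]
    rw [MvPolynomial.X, MvPolynomial.monomial_mul, one_mul, add_comm, polyInner_monomial,
      polyInner_monomial, MvPolynomial.coeff_pderiv, ← Finset.mul_prod_erase _ _ (Finset.mem_univ i),
      ← Finset.mul_prod_erase _ _ (Finset.mem_univ i)]
    have h : ∏ j ∈ Finset.univ.erase i, ((α + Finsupp.single i 1 : Fin n →₀ ℕ) j).factorial =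
        ∏ j ∈ Finset.univ.erase i, (α j).factorial :=
      Finset.prod_congr rfl fun j hj => by
        rw [Finsupp.add_apply, Finsupp.single_eq_of_ne (Finset.ne_of_mem_erase hj), add_zero]
    rw [h, Finsupp.add_apply, Finsupp.single_eq_same, Nat.factorial_succ]
    push_cast
    ring
  exact LinearMap.congr_fun₂ key f g

theorem partialPow_succ {n : ℕ} (i : Fin n) (l : ℕ) (f : Poly n) :
    partialPow n i (l + 1) f = MvPolynomial.pderiv i (partialPow n i l f) := by
  rw [partialPow, pow_succ']
  rfl

theorem polyInner_X_pow_mul {n : ℕ} (i : Fin n) (l : ℕ) (f g : Poly n) :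
    polyInner n (MvPolynomial.X i ^ l * f) g = polyInner n f (partialPow n i l g) := by
  induction l generalizing f with
  | zero => simp [partialPow]
  | succ l ih => rw [pow_succ, mul_assoc, ih, polyInner_X_mul, partialPow_succ]

theorem formInner_tmul {n : ℕ} (f g : Poly n) (u v : Grass n) :
    formInner n (f ⊗ₜ u) (g ⊗ₜ v) = polyInner n f g * grassInner n u v := by
  simp [formInner, mul_comm]

theorem formInner_comm {n : ℕ} (x y : Form n) : formInner n x y = formInner n y x := by
  have key : formInner n = LinearMap.flip (formInner n) := by
    apply TensorProduct.ext'
    intro f u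
    apply TensorProduct.ext'
    intro g v
    rw [LinearMap.flip_apply, formInner_tmul, formInner_tmul, polyInner_comm, grassInner_comm]
  exact LinearMap.congr_fun₂ key x y

/-- The inner product is definite: monomial forms are an orthogonal basis of positive norms. -/
theorem formInner_self_eq_zero {n : ℕ} {x : Form n} (h : formInner n x x = 0) : x = 0 := by
  set b := (MvPolynomial.basisMonomials (Fin n) ℝ).tensorProduct (grassBasis n) with hb
  have hbb : ∀ p q, formInner n (b p) (b q) =
      if p = q then ((∏ i, (p.1 i).factorial : ℕ) : ℝ) else 0 := by
    rintro ⟨α, S⟩ ⟨β, T⟩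
    rw [hb, Module.Basis.tensorProduct_apply, Module.Basis.tensorProduct_apply, formInner_tmul,
      MvPolynomial.coe_basisMonomials, polyInner_monomial_monomial, grassInner_grassBasis]
    simp only [Prod.mk.injEq]
    split_ifs <;> simp_all
  have h1 := LinearMap.sum_repr_mul_repr_mul (B := formInner n) b b x x
  rw [h, Finsupp.sum] at h1
  have h2 : ∀ p, (b.repr x).sum (fun q c => b.repr x p • c • formInner n (b p) (b q)) =
      b.repr x p * b.repr x p * ((∏ i, (p.1 i).factorial : ℕ) : ℝ) := by
    intro p
    rw [Finsupp.sum, Finset.sum_eq_single p]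
    · rw [hbb, if_pos rfl]; simp [mul_assoc]
    · intro q _ hq
      rw [hbb, if_neg hq.symm]; simp
    · intro hp
      rw [Finsupp.notMem_support_iff] at hp
      simp [hp]
  rw [Finset.sum_congr rfl fun p _ => h2 p, Finset.sum_eq_zero_iff_of_nonneg] at h1
  · apply b.repr.injective
    ext p
    by_contra hp
    have := h1 p (by rw [Finsupp.mem_support_iff]; simpa using hp)
    rw [mul_eq_zero, mul_self_eq_zero, Nat.cast_eq_zero, Finset.prod_eq_zero_iff] at this
    obtain h | ⟨i, _, h⟩ := this
    · exact hp (by simpa using h)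
    · exact Nat.factorial_ne_zero _ h
  · intro p _
    exact mul_nonneg (mul_self_nonneg _) (Nat.cast_nonneg _)

/-! ### Operators built from one variable at a time -/

/-- The operator `∑ⱼ aⱼ ⊗ cⱼ` on forms, for operators `aⱼ` on polynomials and `cⱼ` on the
Grassmann algebra. -/
def sumOp {n : ℕ} (a : Fin n → Module.End ℝ (Poly n)) (c : Fin n → Module.End ℝ (Grass n)) :
    Module.End ℝ (Form n) :=
  ∑ j, TensorProduct.map (a j) (c j)

theorem sumOp_tmul {n : ℕ} (a : Fin n → Module.End ℝ (Poly n))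
    (c : Fin n → Module.End ℝ (Grass n)) (f : Poly n) (u : Grass n) :
    sumOp a c (f ⊗ₜ u) = ∑ j, a j f ⊗ₜ c j u := by
  simp [sumOp]

theorem formInner_sumOp {n : ℕ} {a a' : Fin n → Module.End ℝ (Poly n)}
    {c c' : Fin n → Module.End ℝ (Grass n)}
    (ha : ∀ i f g, polyInner n (a i f) g = polyInner n f (a' i g))
    (hc : ∀ i u v, grassInner n (c i u) v = grassInner n u (c' i v)) (x y : Form n) :
    formInner n (sumOp a c x) y = formInner n x (sumOp a' c' y) := by
  have key : (formInner n).compl₁₂ (sumOp a c) LinearMap.id =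
      (formInner n).compl₁₂ LinearMap.id (sumOp a' c') := by
    apply TensorProduct.ext'
    intro f u
    apply TensorProduct.ext'
    intro g v
    simp only [LinearMap.compl₁₂_apply, LinearMap.id_apply, sumOp_tmul, map_sum,
      LinearMap.sum_apply, formInner_tmul, ha, hc]
  exact LinearMap.congr_fun₂ key x y

theorem sumOp_mul_sumOp {n : ℕ} (a a' : Fin n → Module.End ℝ (Poly n))
    (c c' : Fin n → Module.End ℝ (Grass n)) :
    sumOp a c * sumOp a' c' = ∑ i, ∑ j, TensorProduct.map (a i * a' j) (c i * c' j) := by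
  simp only [sumOp, Finset.sum_mul_sum, TensorProduct.map_mul]

theorem sumOp_mul_add {n : ℕ} {a a' : Fin n → Module.End ℝ (Poly n)}
    (c c' : Fin n → Module.End ℝ (Grass n)) (h : ∀ i j, a i * a' j = a' j * a i) :
    sumOp a c * sumOp a' c' + sumOp a' c' * sumOp a c =
      ∑ i, ∑ j, TensorProduct.map (a i * a' j) (c i * c' j + c' j * c i) := by
  rw [sumOp_mul_sumOp, sumOp_mul_sumOp, Finset.sum_comm (f := fun i j =>
    TensorProduct.map (a' i * a j) (c' i * c j)), ← Finset.sum_add_distrib]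
  refine Finset.sum_congr rfl fun i _ => ?_
  rw [← Finset.sum_add_distrib]
  refine Finset.sum_congr rfl fun j _ => ?_
  rw [TensorProduct.map_add_right, h]

theorem sumOp_anticomm {n : ℕ} {a a' : Fin n → Module.End ℝ (Poly n)}
    {c c' : Fin n → Module.End ℝ (Grass n)} (h : ∀ i j, a i * a' j = a' j * a i)
    (hc : ∀ i j, c i * c' j + c' j * c i = 0) :
    sumOp a c * sumOp a' c' + sumOp a' c' * sumOp a c = 0 := by
  rw [sumOp_mul_add c c' h]
  simp [hc]

theorem sumOp_comm {n : ℕ} {a a' : Fin n → Module.End ℝ (Poly n)}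
    {c c' : Fin n → Module.End ℝ (Grass n)} (h : ∀ i j, a i * a' j = a' j * a i)
    (hc : ∀ i j, c i * c' j = c' j * c i) :
    sumOp a c * sumOp a' c' = sumOp a' c' * sumOp a c := by
  rw [sumOp_mul_sumOp, sumOp_mul_sumOp, Finset.sum_comm]
  simp only [h, hc]

theorem formRep_tmul {n : ℕ} (σ : Equiv.Perm (Fin n)) (f : Poly n) (u : Grass n) :
    formRep n σ (f ⊗ₜ u) =
      MvPolynomial.rename σ f ⊗ₜ ExteriorAlgebra.map (permVec n σ) u := rfl

theorem formRep_mul {n : ℕ} (σ : Equiv.Perm (Fin n)) (x y : Form n) :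
    formRep n σ (x * y) = formRep n σ x * formRep n σ y :=
  map_mul (permAlg n σ) x y

theorem formRep_sumOp {n : ℕ} {a : Fin n → Module.End ℝ (Poly n)}
    {c : Fin n → Module.End ℝ (Grass n)} (σ : Equiv.Perm (Fin n))
    (ha : ∀ i f, MvPolynomial.rename σ (a i f) = a (σ i) (MvPolynomial.rename σ f))
    (hc : ∀ i u, ExteriorAlgebra.map (permVec n σ) (c i u) =
      c (σ i) (ExteriorAlgebra.map (permVec n σ) u)) (x : Form n) :
    formRep n σ (sumOp a c x) = sumOp a c (formRep n σ x) := by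
  have key : formRep n σ ∘ₗ sumOp a c = sumOp a c ∘ₗ formRep n σ := by
    apply TensorProduct.ext'
    intro f u
    simp only [LinearMap.comp_apply, sumOp_tmul, map_sum, formRep_tmul, ha, hc]
    exact Equiv.sum_comp σ (fun i => a i (MvPolynomial.rename σ f) ⊗ₜ[ℝ]
      c i (ExteriorAlgebra.map (permVec n σ) u))
  exact LinearMap.congr_fun key x

theorem partialPow_comm {n : ℕ} (i j : Fin n) (k l : ℕ) :
    partialPow n i k * partialPow n j l = partialPow n j l * partialPow n i k := by
  refine Commute.pow_pow ?_ k l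
  have h : ⁅(MvPolynomial.pderiv i : Derivation ℝ (Poly n) (Poly n)),
      (MvPolynomial.pderiv j : Derivation ℝ (Poly n) (Poly n))⁆ = 0 := by
    refine MvPolynomial.derivation_ext fun k => ?_
    rw [Derivation.commutator_apply, MvPolynomial.pderiv_X, MvPolynomial.pderiv_X]
    simp [Pi.single_apply, apply_ite]
  refine LinearMap.ext fun f => ?_
  have := congrArg (fun d => d f) h
  rw [Derivation.commutator_apply, Derivation.zero_apply, sub_eq_zero] at this
  exact this

theorem rename_partialPow {n : ℕ} (σ : Equiv.Perm (Fin n)) (i : Fin n) (l : ℕ) (f : Poly n) :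
    MvPolynomial.rename σ (partialPow n i l f) =
      partialPow n (σ i) l (MvPolynomial.rename σ f) := by
  induction l with
  | zero => rfl
  | succ l ih =>
    rw [partialPow_succ, partialPow_succ, ← ih, MvPolynomial.pderiv_rename σ.injective]

/-! ### The operators `d_l` and the vector fields -/

/-- The operator `d_l (f dx_I) = ∑ⱼ (∂ⱼˡ f) dxⱼ ∧ dx_I`. -/
def opd (n l : ℕ) : Module.End ℝ (Form n) :=
  sumOp (fun j => partialPow n j l) (fun j => LinearMap.mulLeft ℝ (dx n j))

/-- The contraction `∑ⱼ xⱼˡ ι(dxⱼ)` with the invariant vector field `∑ⱼ xⱼˡ ∂ⱼ`. -/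
def fieldContract (n l : ℕ) : Module.End ℝ (Form n) :=
  sumOp (fun j => LinearMap.mulLeft ℝ (MvPolynomial.X j ^ l)) (fun j => contract n j)

/-- The power sum `p_k` as a form. -/
def powerSum (n k : ℕ) : Form n := (∑ i : Fin n, (MvPolynomial.X i : Poly n) ^ k) ⊗ₜ[ℝ] 1

/-- The invariant `1`-form `∑ⱼ xⱼˡ dxⱼ`, a multiple of `dp_{l+1}`. -/
def powerForm (n l : ℕ) : Form n := ∑ j : Fin n, ((MvPolynomial.X j : Poly n) ^ l) ⊗ₜ[ℝ] dx n j

theorem opD_eq (n k : ℕ) : opD n k = sumOp (fun j => partialPow n j k) (fun _ => 1) := rfl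

theorem opDelta_eq (n l : ℕ) : opDelta n l = sumOp (fun j => partialPow n j l) (contract n) := rfl

theorem powerSum_mul (n k : ℕ) (x : Form n) : powerSum n k * x =
    sumOp (fun j => LinearMap.mulLeft ℝ (MvPolynomial.X j ^ k)) (fun _ => 1) x := by
  induction x using TensorProduct.induction_on with
  | zero => simp
  | add x y hx hy => rw [mul_add, hx, hy, map_add]
  | tmul f u => simp [powerSum, sumOp_tmul, Finset.sum_mul, TensorProduct.sum_tmul]

theorem powerForm_mul (n l : ℕ) (x : Form n) : powerForm n l * x =
    sumOp (fun j => LinearMap.mulLeft ℝ (MvPolynomial.X j ^ l))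
      (fun j => LinearMap.mulLeft ℝ (dx n j)) x := by
  induction x using TensorProduct.induction_on with
  | zero => simp
  | add x y hx hy => rw [mul_add, hx, hy, map_add]
  | tmul f u => simp [powerForm, sumOp_tmul, Finset.sum_mul]

theorem formInner_powerSum_mul {n : ℕ} (k : ℕ) (x y : Form n) :
    formInner n (powerSum n k * x) y = formInner n x (opD n k y) := by
  rw [powerSum_mul, opD_eq]
  exact formInner_sumOp (a := fun j => LinearMap.mulLeft ℝ (MvPolynomial.X j ^ k))
    (a' := fun j => partialPow n j k) (c := fun _ => 1) (c' := fun _ => 1)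
    (fun i f g => polyInner_X_pow_mul i k f g) (fun i u v => rfl) x y

theorem formInner_powerForm_mul {n : ℕ} (l : ℕ) (x y : Form n) :
    formInner n (powerForm n l * x) y = formInner n x (opDelta n l y) := by
  rw [powerForm_mul, opDelta_eq]
  exact formInner_sumOp (a := fun j => LinearMap.mulLeft ℝ (MvPolynomial.X j ^ l))
    (a' := fun j => partialPow n j l) (c := fun j => LinearMap.mulLeft ℝ (dx n j))
    (c' := contract n) (fun i f g => polyInner_X_pow_mul i l f g) grassInner_dx_mul x y

/-- The operator `d_l` is adjoint to the contraction with the vector field `∑ⱼ xⱼˡ ∂ⱼ`. -/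
theorem formInner_opd {n : ℕ} (l : ℕ) (x y : Form n) :
    formInner n (opd n l x) y = formInner n x (fieldContract n l y) := by
  refine formInner_sumOp (a := fun j => partialPow n j l)
    (a' := fun j => LinearMap.mulLeft ℝ (MvPolynomial.X j ^ l))
    (c := fun j => LinearMap.mulLeft ℝ (dx n j))
    (c' := contract n) (fun i f g => ?_) grassInner_dx_mul x y
  rw [polyInner_comm, ← polyInner_X_pow_mul, polyInner_comm]
  rfl

theorem opd_anticomm (n k l : ℕ) : opd n k * opd n l + opd n l * opd n k = 0 := by
  refine sumOp_anticomm (fun i j => partialPow_comm i j k l) fun i j => ?_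
  refine LinearMap.ext fun u => ?_
  simp only [LinearMap.add_apply, Module.End.mul_apply, LinearMap.mulLeft_apply, ← mul_assoc,
    ← add_mul, dx_mul_dx_add, zero_mul, LinearMap.zero_apply]

theorem mulLeft_comm {n : ℕ} (f g : Poly n) : LinearMap.mulLeft ℝ f * LinearMap.mulLeft ℝ g =
    LinearMap.mulLeft ℝ g * LinearMap.mulLeft ℝ f := by
  refine LinearMap.ext fun u => ?_
  simp only [Module.End.mul_apply, LinearMap.mulLeft_apply]
  ring

theorem fieldContract_anticomm (n k l : ℕ) :
    fieldContract n k * fieldContract n l + fieldContract n l * fieldContract n k = 0 :=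
  sumOp_anticomm (fun _ _ => mulLeft_comm _ _) contract_anticomm

theorem opD_comm_opd (n k l : ℕ) : opD n k * opd n l = opd n l * opD n k :=
  sumOp_comm (fun i j => partialPow_comm i j k l) fun _ _ => rfl

/-- A Cartan formula. For `l ≥ 1` the right-hand side annihilates harmonic forms, which is why `d_l`
preserves them. -/
theorem opDelta_opd (n k l : ℕ) :
    opDelta n k * opd n l + opd n l * opDelta n k = opD n (k + l) := by
  rw [opDelta_eq, opd, sumOp_mul_add _ _ fun i j => partialPow_comm i j k l]
  simp only [contract_dx_anticomm]
  rw [opD]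
  refine Finset.sum_congr rfl fun i _ => ?_
  rw [Finset.sum_eq_single i]
  · rw [if_pos rfl, partialPow, partialPow, ← pow_add]
    rfl
  · intro j _ hj
    rw [if_neg hj.symm, TensorProduct.map_zero_right]
  · simp

theorem formRep_opD {n : ℕ} (k : ℕ) (σ : Equiv.Perm (Fin n)) (x : Form n) :
    formRep n σ (opD n k x) = opD n k (formRep n σ x) :=
  formRep_sumOp σ (fun i f => rename_partialPow σ i k f) (fun _ _ => rfl) x

theorem formRep_opd {n : ℕ} (l : ℕ) (σ : Equiv.Perm (Fin n)) (x : Form n) :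
    formRep n σ (opd n l x) = opd n l (formRep n σ x) :=
  formRep_sumOp σ (fun i f => rename_partialPow σ i l f)
    (fun i u => by simp only [LinearMap.mulLeft_apply, map_mul, map_dx]) x

theorem formRep_fieldContract {n : ℕ} (l : ℕ) (σ : Equiv.Perm (Fin n)) (x : Form n) :
    formRep n σ (fieldContract n l x) = fieldContract n l (formRep n σ x) :=
  formRep_sumOp σ (fun i f => by simp) (contract_map σ) x

theorem fieldContract_smul {n : ℕ} (l : ℕ) (f : Poly n) (x : Form n) :
    fieldContract n l (f • x) = f • fieldContract n l x := by
  induction x using TensorProduct.induction_on with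
  | zero => simp
  | add x y hx hy => rw [smul_add, map_add, hx, hy, map_add, smul_add]
  | tmul g u =>
    rw [TensorProduct.smul_tmul', fieldContract, sumOp_tmul, sumOp_tmul, Finset.smul_sum]
    refine Finset.sum_congr rfl fun j _ => ?_
    rw [TensorProduct.smul_tmul']
    simp only [LinearMap.mulLeft_apply, smul_eq_mul]
    rw [mul_left_comm]

theorem formRep_powerSum {n : ℕ} (k : ℕ) (σ : Equiv.Perm (Fin n)) :
    formRep n σ (powerSum n k) = powerSum n k := by
  rw [powerSum, formRep_tmul, map_one, map_sum]
  simp only [map_pow, MvPolynomial.rename_X]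
  rw [Equiv.sum_comp σ (fun i => (MvPolynomial.X i ^ k : Poly n))]

theorem formRep_powerForm {n : ℕ} (l : ℕ) (σ : Equiv.Perm (Fin n)) :
    formRep n σ (powerForm n l) = powerForm n l := by
  rw [powerForm, map_sum]
  simp only [formRep_tmul, map_pow, MvPolynomial.rename_X, map_dx]
  rw [Equiv.sum_comp σ (fun i => (MvPolynomial.X i ^ l : Poly n) ⊗ₜ[ℝ] dx n i)]

/-! ### Anticommuting operators and the Grassmann algebra -/

/-- The action of the Grassmann algebra on forms in which the generators `dxᵢ` act by the given
anticommuting operators. -/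
def grassHom {n : ℕ} (T : Fin n → Module.End ℝ (Form n))
    (h : ∀ i j, T i * T j + T j * T i = 0) : Grass n →ₐ[ℝ] Module.End ℝ (Form n) :=
  ExteriorAlgebra.lift ℝ ⟨Fintype.linearCombination ℝ T, fun v => by
    have h1 : ∑ i, ∑ j, (v i * v j) • (T i * T j + T j * T i) = 0 := by simp [h]
    have h2 : ∑ i, ∑ j, (v i * v j) • (T j * T i) = ∑ i, ∑ j, (v i * v j) • (T i * T j) := by
      rw [Finset.sum_comm]
      simp only [mul_comm]
    simp only [smul_add, Finset.sum_add_distrib, h2] at h1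
    rw [← two_smul ℝ, smul_eq_zero_iff_right two_ne_zero] at h1
    rw [Fintype.linearCombination_apply, Finset.sum_mul_sum, ← h1]
    simp only [smul_mul_smul_comm]⟩

theorem grassHom_dx {n : ℕ} (T : Fin n → Module.End ℝ (Form n))
    (h : ∀ i j, T i * T j + T j * T i = 0) (i : Fin n) : grassHom T h (dx n i) = T i := by
  rw [grassHom, dx, ExteriorAlgebra.lift_ι_apply, Fintype.linearCombination_apply_single, one_smul]

/-- The action of the Grassmann algebra in which the generator `dx n l` acts as `d_l`. -/
def opdHom (n : ℕ) : Grass n →ₐ[ℝ] Module.End ℝ (Form n) :=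
  grassHom (fun l => opd n l) fun i j => opd_anticomm n i j

/-- The action of the Grassmann algebra in which the generator `dx n l` acts as the contraction
with `∑ⱼ xⱼˡ ∂ⱼ`. -/
def fieldHom (n : ℕ) : Grass n →ₐ[ℝ] Module.End ℝ (Form n) :=
  grassHom (fun l => fieldContract n l) fun i j => fieldContract_anticomm n i j


/-! ### The ideal generated by power sums and their differentials -/

/-- The automorphism of `Ωₙ` acting by `(-1)^s` on `s`-forms. -/
def gradeInvolution (n : ℕ) : Form n →ₐ[ℝ] Form n :=
  Algebra.TensorProduct.map (AlgHom.id ℝ (Poly n)) CliffordAlgebra.involute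

theorem gradeInvolution_gradeInvolution {n : ℕ} (x : Form n) :
    gradeInvolution n (gradeInvolution n x) = x := by
  induction x using TensorProduct.induction_on with
  | zero => simp
  | add x y hx hy => rw [map_add, map_add, hx, hy]
  | tmul f u => simp [gradeInvolution]

theorem mul_powerForm {n : ℕ} (l : ℕ) (x : Form n) :
    x * powerForm n l = powerForm n l * gradeInvolution n x := by
  induction x using TensorProduct.induction_on with
  | zero => simp
  | add x y hx hy => rw [add_mul, hx, hy, map_add, mul_add]
  | tmul f u =>
    rw [powerForm, gradeInvolution, Algebra.TensorProduct.map_tmul, Finset.mul_sum, Finset.sum_mul]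
    refine Finset.sum_congr rfl fun j _ => ?_
    rw [Algebra.TensorProduct.tmul_mul_tmul, Algebra.TensorProduct.tmul_mul_tmul, mul_dx, mul_comm]
    rfl

theorem mul_powerSum {n : ℕ} (k : ℕ) (x : Form n) : x * powerSum n k = powerSum n k * x := by
  induction x using TensorProduct.induction_on with
  | zero => simp
  | add x y hx hy => rw [add_mul, hx, hy, mul_add]
  | tmul f u =>
    rw [powerSum, Algebra.TensorProduct.tmul_mul_tmul, Algebra.TensorProduct.tmul_mul_tmul,
      mul_comm, one_mul, mul_one]

/-- The power sums `p_1, …, p_n` and the forms `∑ⱼ xⱼˡ dxⱼ`, `0 ≤ l < n`. -/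
def powerGenerators (n : ℕ) : Set (Form n) :=
  {x | (∃ k ∈ Finset.Icc 1 n, x = powerSum n k) ∨ ∃ l ∈ Finset.range n, x = powerForm n l}

/-- The ideal generated by the power sums and their differentials; it turns out to be the ideal
generated by all invariants of positive degree. -/
def powerIdeal (n : ℕ) : Ideal (Form n) := Ideal.span (powerGenerators n)

instance powerIdeal_isTwoSided (n : ℕ) : (powerIdeal n).IsTwoSided := by
  refine ⟨fun {a} b ha => ?_⟩
  rw [powerIdeal] at ha
  induction ha using Submodule.span_induction with
  | mem x hx =>
    have hx' : x ∈ powerIdeal n := Ideal.subset_span hx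
    obtain ⟨k, _, rfl⟩ | ⟨l, _, rfl⟩ := hx
    · rw [← mul_powerSum]
      exact Ideal.mul_mem_left _ _ hx'
    · rw [← gradeInvolution_gradeInvolution b, ← mul_powerForm]
      exact Ideal.mul_mem_left _ _ hx'
  | zero => simp
  | add x y _ _ hx hy => rw [add_mul]; exact add_mem hx hy
  | smul c x _ hx => rw [smul_eq_mul, mul_assoc]; exact Ideal.mul_mem_left _ _ hx

/-- The ideal of the polynomial ring generated by the power sums `p_1, …, p_n`. -/
def psumIdeal (n : ℕ) : Ideal (Poly n) :=
  Ideal.span {f | ∃ k ∈ Finset.Icc 1 n, f = MvPolynomial.psum (Fin n) ℝ k}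

theorem tmul_one_mem_powerIdeal {n : ℕ} {f : Poly n} (hf : f ∈ psumIdeal n) :
    f ⊗ₜ 1 ∈ powerIdeal n := by
  rw [psumIdeal] at hf
  induction hf using Submodule.span_induction with
  | mem x hx =>
    obtain ⟨k, hk, rfl⟩ := hx
    exact Ideal.subset_span (Or.inl ⟨k, hk, rfl⟩)
  | zero => simp
  | add x y _ _ hx hy => rw [TensorProduct.add_tmul]; exact add_mem hx hy
  | smul c x _ hx =>
    have : (c • x) ⊗ₜ[ℝ] (1 : Grass n) = (c ⊗ₜ 1) * (x ⊗ₜ 1) := by simp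
    rw [this]
    exact Ideal.mul_mem_left _ _ hx

theorem esymm_mem_psumIdeal {n k : ℕ} (hk : k ∈ Finset.Icc 1 n) :
    MvPolynomial.esymm (Fin n) ℝ k ∈ psumIdeal n := by
  rw [Finset.mem_Icc] at hk
  have h : (k : Poly n) * MvPolynomial.esymm (Fin n) ℝ k ∈ psumIdeal n := by
    rw [MvPolynomial.mul_esymm_eq_sum]
    refine Ideal.mul_mem_left _ _ (Ideal.sum_mem _ fun a ha => Ideal.mul_mem_left _ _ ?_)
    rw [Finset.mem_filter, Finset.HasAntidiagonal.mem_antidiagonal] at ha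
    exact Ideal.subset_span ⟨a.2, by rw [Finset.mem_Icc]; omega, rfl⟩
  have h2 : MvPolynomial.C (k : ℝ)⁻¹ * ((k : Poly n) * MvPolynomial.esymm (Fin n) ℝ k) =
      MvPolynomial.esymm (Fin n) ℝ k := by
    have hk0 : (k : ℝ) ≠ 0 := by
      have : k ≠ 0 := by omega
      exact_mod_cast this
    rw [← mul_assoc, ← map_natCast (MvPolynomial.C : ℝ →+* Poly n), ← map_mul,
      inv_mul_cancel₀ hk0, map_one, one_mul]
  rw [← h2]
  exact Ideal.mul_mem_left _ _ h

/-- High powers of `xᵢ` lie in the ideal, as `xᵢ` is a root of the monic polynomial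
`∏ⱼ (X - xⱼ)`, whose lower coefficients are elementary symmetric polynomials up to sign. -/
theorem X_pow_mem_psumIdeal {n m : ℕ} (i : Fin n) (hm : n ≤ m) :
    (MvPolynomial.X i : Poly n) ^ m ∈ psumIdeal n := by
  obtain ⟨m, rfl⟩ := Nat.exists_eq_add_of_le hm
  rw [pow_add]
  refine Ideal.mul_mem_right _ _ ?_
  have h := congrArg (Polynomial.eval (-(MvPolynomial.X i : Poly n)))
    (MvPolynomial.prod_C_add_X_eq_sum_esymm ℝ (Fin n))
  rw [Polynomial.eval_prod, Finset.prod_eq_zero (Finset.mem_univ i) (by simp),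
    Polynomial.eval_finsetSum, Finset.sum_range_succ', Fintype.card_fin] at h
  simp only [Polynomial.eval_mul, Polynomial.eval_C, Polynomial.eval_pow, Polynomial.eval_X,
    MvPolynomial.esymm_zero, one_mul, Nat.sub_zero] at h
  have h2 : (-(MvPolynomial.X i : Poly n)) ^ n ∈ psumIdeal n := by
    rw [eq_neg_of_add_eq_zero_right h.symm]
    refine neg_mem (Ideal.sum_mem _ fun k hk => Ideal.mul_mem_right _ _ (esymm_mem_psumIdeal ?_))
    rw [Finset.mem_range] at hk
    rw [Finset.mem_Icc]
    omega
  rw [neg_pow] at h2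
  have h3 := Ideal.mul_mem_left _ ((-1) ^ n) h2
  rwa [← mul_assoc, ← mul_pow, neg_one_mul, neg_neg, one_pow, one_mul] at h3

theorem powerSum_mem {n k : ℕ} (hk : 1 ≤ k) : powerSum n k ∈ powerIdeal n := by
  by_cases hkn : k ≤ n
  · exact Ideal.subset_span (Or.inl ⟨k, Finset.mem_Icc.2 ⟨hk, hkn⟩, rfl⟩)
  · exact tmul_one_mem_powerIdeal (Ideal.sum_mem _ fun i _ => X_pow_mem_psumIdeal i (by omega))

theorem powerForm_mem (n l : ℕ) : powerForm n l ∈ powerIdeal n := by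
  by_cases hl : l < n
  · exact Ideal.subset_span (Or.inr ⟨l, Finset.mem_range.2 hl, rfl⟩)
  · refine Ideal.sum_mem _ fun j _ => ?_
    have : ((MvPolynomial.X j : Poly n) ^ l) ⊗ₜ[ℝ] dx n j =
        (1 ⊗ₜ dx n j) * (((MvPolynomial.X j : Poly n) ^ l) ⊗ₜ 1) := by simp
    rw [this]
    exact Ideal.mul_mem_left _ _ (tmul_one_mem_powerIdeal (X_pow_mem_psumIdeal j (by omega)))

/-! ### Invariants lie in the ideal generated by the power sums and their differentials -/

/-- The coordinate `x_i` as a form. -/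
def xForm {n : ℕ} (i : Fin n) : Form n := MvPolynomial.X i ⊗ₜ 1

/-- The differential `dx_i` as a form. -/
def dForm {n : ℕ} (i : Fin n) : Form n := 1 ⊗ₜ dx n i

/-- The algebra of forms in the variables `x_i`, `i ∈ S`, and their differentials. -/
def formsIn {n : ℕ} (S : Finset (Fin n)) : Subalgebra ℝ (Form n) :=
  Algebra.adjoin ℝ {x | ∃ i ∈ S, x = xForm i ∨ x = dForm i}

theorem xForm_comm {n : ℕ} (i : Fin n) (x : Form n) : x * xForm i = xForm i * x := by
  induction x using TensorProduct.induction_on with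
  | zero => simp
  | add x y hx hy => rw [add_mul, hx, hy, mul_add]
  | tmul f u => simp [xForm, mul_comm]

theorem dForm_anticomm {n : ℕ} (i j : Fin n) :
    dForm i * dForm j = (-1 : ℝ) • (dForm j * dForm i) := by
  have := eq_neg_of_add_eq_zero_left (dx_mul_dx_add i j)
  rw [dForm, dForm, Algebra.TensorProduct.tmul_mul_tmul, Algebra.TensorProduct.tmul_mul_tmul, this,
    ← TensorProduct.tmul_smul, neg_one_smul]

theorem dForm_mul_self {n : ℕ} (i : Fin n) : dForm i * dForm i = 0 := by
  simp [dForm, dx]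

theorem xForm_mem {n : ℕ} {S : Finset (Fin n)} {i : Fin n} (hi : i ∈ S) : xForm i ∈ formsIn S :=
  Algebra.subset_adjoin ⟨i, hi, Or.inl rfl⟩

theorem dForm_mem {n : ℕ} {S : Finset (Fin n)} {i : Fin n} (hi : i ∈ S) : dForm i ∈ formsIn S :=
  Algebra.subset_adjoin ⟨i, hi, Or.inr rfl⟩

/-- Forms in the variables indexed by `insert i S` can be written with the last variable on the
right, as combinations of `w xᵢᵏ` and `w xᵢᵏ dxᵢ` with `w` in the variables indexed by `S`. -/
theorem mem_span_of_mem_formsIn_insert {n : ℕ} (i : Fin n) (S : Finset (Fin n)) {x : Form n}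
    (hx : x ∈ formsIn (insert i S)) :
    x ∈ Submodule.span ℝ {y | ∃ w ∈ formsIn S, ∃ k : ℕ,
      y = w * xForm i ^ k ∨ y = w * (xForm i ^ k * dForm i)} := by
  set M := Submodule.span ℝ {y | ∃ w ∈ formsIn S, ∃ k : ℕ,
      y = w * xForm i ^ k ∨ y = w * (xForm i ^ k * dForm i)} with hM
  have h1 : ∀ w ∈ formsIn S, ∀ k : ℕ, w * xForm i ^ k ∈ M := fun w hw k =>
    Submodule.subset_span ⟨w, hw, k, Or.inl rfl⟩
  have h2 : ∀ w ∈ formsIn S, ∀ k : ℕ, w * (xForm i ^ k * dForm i) ∈ M := fun w hw k =>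
    Submodule.subset_span ⟨w, hw, k, Or.inr rfl⟩
  have hx0 : ∀ m ∈ M, ∀ j ∈ insert i S, m * xForm j ∈ M := by
    intro m hm j hj
    induction hm using Submodule.span_induction with
    | zero => simp
    | add a b _ _ ha hb => rw [add_mul]; exact add_mem ha hb
    | smul c a _ ha => rw [smul_mul_assoc]; exact Submodule.smul_mem _ _ ha
    | mem y hy =>
      obtain ⟨w, hw, k, rfl | rfl⟩ := hy <;> obtain rfl | hj := Finset.mem_insert.1 hj
      · rw [mul_assoc, ← pow_succ]
        exact h1 w hw _
      · rw [mul_assoc, xForm_comm j, ← mul_assoc]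
        exact h1 _ (mul_mem hw (xForm_mem hj)) k
      · rw [mul_assoc, xForm_comm, ← mul_assoc (xForm j), ← pow_succ']
        exact h2 w hw _
      · rw [mul_assoc, xForm_comm j, ← mul_assoc]
        exact h2 _ (mul_mem hw (xForm_mem hj)) k
  have hd0 : ∀ m ∈ M, ∀ j ∈ insert i S, m * dForm j ∈ M := by
    intro m hm j hj
    induction hm using Submodule.span_induction with
    | zero => simp
    | add a b _ _ ha hb => rw [add_mul]; exact add_mem ha hb
    | smul c a _ ha => rw [smul_mul_assoc]; exact Submodule.smul_mem _ _ ha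
    | mem y hy =>
      have hc : ∀ k, xForm i ^ k * dForm j = dForm j * xForm i ^ k := fun k =>
        (Commute.pow_right (xForm_comm i (dForm j)) k).eq.symm
      obtain ⟨w, hw, k, rfl | rfl⟩ := hy <;> obtain rfl | hj := Finset.mem_insert.1 hj
      · rw [mul_assoc]
        exact h2 w hw _
      · rw [mul_assoc, hc, ← mul_assoc]
        exact h1 _ (mul_mem hw (dForm_mem hj)) k
      · rw [mul_assoc, mul_assoc, dForm_mul_self, mul_zero, mul_zero]
        exact zero_mem _
      · rw [mul_assoc, mul_assoc, dForm_anticomm, mul_smul_comm, mul_smul_comm,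
          ← mul_assoc (_ ^ k), hc, mul_assoc, ← mul_assoc]
        exact Submodule.smul_mem _ _ (h2 _ (mul_mem hw (dForm_mem hj)) k)
  have key : ∀ m ∈ M, m * x ∈ M := by
    induction hx using Algebra.adjoin_induction with
    | mem y hy =>
      obtain ⟨j, hj, rfl | rfl⟩ := hy
      · exact fun m hm => hx0 m hm j hj
      · exact fun m hm => hd0 m hm j hj
    | algebraMap r =>
      intro m hm
      rw [← Algebra.commutes, ← Algebra.smul_def]
      exact Submodule.smul_mem _ _ hm
    | add a b _ _ ha hb => intro m hm; rw [mul_add]; exact add_mem (ha m hm) (hb m hm)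
    | mul a b _ _ ha hb => intro m hm; rw [← mul_assoc]; exact hb _ (ha m hm)
  have h3 := key 1 (by simpa using h1 1 (one_mem _) 0)
  rwa [one_mul] at h3

theorem formsIn_univ (n : ℕ) (x : Form n) : x ∈ formsIn (Finset.univ : Finset (Fin n)) := by
  induction x using TensorProduct.induction_on with
  | zero => exact zero_mem _
  | add x y hx hy => exact add_mem hx hy
  | tmul f u =>
    have h : f ⊗ₜ[ℝ] u = (f ⊗ₜ 1) * (1 ⊗ₜ u) := by simp
    rw [h]
    refine mul_mem ?_ ?_
    · induction f using MvPolynomial.induction_on with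
      | C r =>
        have : (MvPolynomial.C r : Poly n) ⊗ₜ[ℝ] (1 : Grass n) = algebraMap ℝ (Form n) r := rfl
        rw [this]
        exact Subalgebra.algebraMap_mem _ _
      | add p q hp hq => rw [TensorProduct.add_tmul]; exact add_mem (hp (by simp)) (hq (by simp))
      | mul_X p i hp =>
        have : (p * MvPolynomial.X i) ⊗ₜ[ℝ] (1 : Grass n) = (p ⊗ₜ 1) * xForm i := by simp [xForm]
        rw [this]
        exact mul_mem (hp (by simp)) (xForm_mem (Finset.mem_univ i))
    · clear h
      induction u using CliffordAlgebra.left_induction with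
      | algebraMap r =>
        have : (1 : Poly n) ⊗ₜ[ℝ] (algebraMap ℝ (Grass n) r) = algebraMap ℝ (Form n) r := by
          rw [Algebra.algebraMap_eq_smul_one, Algebra.algebraMap_eq_smul_one,
            TensorProduct.tmul_smul]
          rfl
        erw [this]
        exact Subalgebra.algebraMap_mem _ _
      | add x y hx hy => rw [TensorProduct.tmul_add]; exact add_mem hx hy
      | ι_mul x v hx =>
        have h1 : v = ∑ i, v i • (Pi.single i 1 : Fin n → ℝ) := by
          ext j
          simp [Finset.sum_apply, Pi.single_apply]
        have h2 : (1 : Poly n) ⊗ₜ[ℝ] (ExteriorAlgebra.ι ℝ v * x) =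
            (∑ i, v i • dForm i) * (1 ⊗ₜ x) := by
          conv_lhs => rw [h1]
          rw [map_sum, Finset.sum_mul, Finset.sum_mul, TensorProduct.tmul_sum]
          refine Finset.sum_congr rfl fun i _ => ?_
          rw [map_smul, smul_mul_assoc, TensorProduct.tmul_smul, smul_mul_assoc, dForm,
            Algebra.TensorProduct.tmul_mul_tmul, one_mul, dx]
        erw [h2]
        exact mul_mem (sum_mem fun i _ => Subalgebra.smul_mem _ (dForm_mem (Finset.mem_univ i)) _)
          hx

/-- The sum of the images of a form under all permutations. -/
def symmetrize (n : ℕ) : Module.End ℝ (Form n) := ∑ σ : Equiv.Perm (Fin n), formRep n σ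

theorem symmetrize_apply {n : ℕ} (x : Form n) : symmetrize n x = ∑ σ, formRep n σ x := by
  simp [symmetrize]

theorem symmetrize_formRep {n : ℕ} (τ : Equiv.Perm (Fin n)) (x : Form n) :
    symmetrize n (formRep n τ x) = symmetrize n x := by
  rw [symmetrize_apply, symmetrize_apply,
    ← Equiv.sum_comp (Equiv.mulRight τ) (fun σ => formRep n σ x)]
  refine Finset.sum_congr rfl fun σ _ => ?_
  rw [Equiv.coe_mulRight, map_mul]
  rfl

theorem symmetrize_mul {n : ℕ} (x : Form n) {y : Form n} (hy : ∀ σ, formRep n σ y = y) :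
    symmetrize n (x * y) = symmetrize n x * y := by
  rw [symmetrize_apply, symmetrize_apply, Finset.sum_mul]
  refine Finset.sum_congr rfl fun σ _ => ?_
  rw [formRep_mul, hy]

theorem formRep_of_mem_formsIn {n : ℕ} {S : Finset (Fin n)} {σ : Equiv.Perm (Fin n)}
    (hσ : ∀ i ∈ S, σ i = i) {x : Form n} (hx : x ∈ formsIn S) : formRep n σ x = x := by
  change permAlg n σ x = x
  induction hx using Algebra.adjoin_induction with
  | mem y hy =>
    obtain ⟨j, hj, rfl | rfl⟩ := hy
    · simp [permAlg, xForm, hσ j hj]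
    · simp [permAlg, dForm, map_dx, hσ j hj]
  | algebraMap r => exact AlgHom.commutes _ _
  | add a b _ _ ha hb => rw [map_add, ha, hb]
  | mul a b _ _ ha hb => rw [map_mul, ha, hb]

theorem formRep_xForm {n : ℕ} (σ : Equiv.Perm (Fin n)) (i : Fin n) :
    formRep n σ (xForm i) = xForm (σ i) := by
  simp [xForm, formRep_tmul]

theorem formRep_dForm {n : ℕ} (σ : Equiv.Perm (Fin n)) (i : Fin n) :
    formRep n σ (dForm i) = dForm (σ i) := by
  simp [dForm, formRep_tmul, map_dx]

/-- The step of the induction: if `a` is a family of forms in one variable whose sum is an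
invariant in the ideal, then, modulo the ideal, the symmetrization of `w a_i` reduces to
symmetrizations of forms in the variables of `w`. -/
theorem symmetrize_mul_mem {n : ℕ} {S : Finset (Fin n)} {i : Fin n} (hi : i ∉ S)
    {N : Submodule ℝ (Form n)} (hN : ∀ x ∈ powerIdeal n, x ∈ N)
    (hS : ∀ w ∈ formsIn S, symmetrize n w ∈ N) {a : Fin n → Form n}
    (ha : ∀ σ j, formRep n σ (a j) = a (σ j)) (haS : ∀ j ∈ S, a j ∈ formsIn S)
    (hsum : ∑ j, a j ∈ powerIdeal n) {w : Form n} (hw : w ∈ formsIn S) :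
    symmetrize n (w * a i) ∈ N := by
  have hinv : ∀ σ, formRep n σ (∑ j, a j) = ∑ j, a j := by
    intro σ
    rw [map_sum]
    simp only [ha]
    exact Equiv.sum_comp σ a
  have h1 : symmetrize n (w * ∑ j, a j) ∈ N := by
    rw [symmetrize_mul _ hinv]
    exact hN _ (Ideal.mul_mem_left _ _ hsum)
  have h2 : ∀ j ∈ Sᶜ, symmetrize n (w * a j) = symmetrize n (w * a i) := by
    intro j hj
    rw [Finset.mem_compl] at hj
    rw [← symmetrize_formRep (Equiv.swap i j), formRep_mul, ha, Equiv.swap_apply_right,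
      formRep_of_mem_formsIn (fun k hk => Equiv.swap_apply_of_ne_of_ne ?_ ?_) hw]
    · rintro rfl; exact hi hk
    · rintro rfl; exact hj hk
  rw [Finset.mul_sum, ← Finset.sum_add_sum_compl S, map_add, map_sum, map_sum,
    Finset.sum_congr rfl h2, Finset.sum_const] at h1
  have h3 := sub_mem h1 (sum_mem fun j (hj : j ∈ S) => hS _ (mul_mem hw (haS j hj)))
  rw [add_sub_cancel_left, ← Nat.cast_smul_eq_nsmul ℝ] at h3
  refine (Submodule.smul_mem_iff _ ?_).1 h3
  have : i ∈ Sᶜ := by simpa using hi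
  exact_mod_cast (Finset.card_pos.2 ⟨i, this⟩).ne'

/-- By induction on the number of variables involved, the symmetrization of every form is a
constant modulo the ideal generated by the power sums and their differentials. -/
theorem symmetrize_mem {n : ℕ} (x : Form n) :
    symmetrize n x ∈ (1 : Submodule ℝ (Form n)) ⊔ (powerIdeal n).restrictScalars ℝ := by
  set N := (1 : Submodule ℝ (Form n)) ⊔ (powerIdeal n).restrictScalars ℝ
  have hN : ∀ x ∈ powerIdeal n, x ∈ N := fun x hx => Submodule.mem_sup_right hx
  suffices h : ∀ S : Finset (Fin n), ∀ w ∈ formsIn S, symmetrize n w ∈ N from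
    h _ x (formsIn_univ n x)
  intro S
  induction S using Finset.induction with
  | empty =>
    intro w hw
    have h0 : {x : Form n | ∃ i ∈ (∅ : Finset (Fin n)), x = xForm i ∨ x = dForm i} = ∅ := by
      ext; simp
    rw [formsIn, h0, Algebra.adjoin_empty, Algebra.mem_bot] at hw
    obtain ⟨c, rfl⟩ := hw
    refine Submodule.mem_sup_left (Submodule.mem_one.2 ⟨n.factorial * c, ?_⟩)
    have h : ∀ σ, formRep n σ (algebraMap ℝ (Form n) c) = algebraMap ℝ (Form n) c :=
      fun σ => (permAlg n σ).commutes c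
    rw [symmetrize_apply, Finset.sum_congr rfl fun σ _ => h σ,
      Finset.sum_const, Finset.card_univ, Fintype.card_perm, Fintype.card_fin, map_mul,
      map_natCast, nsmul_eq_mul]
  | insert i S hi ih =>
    intro w hw
    have h := mem_span_of_mem_formsIn_insert i S hw
    clear hw
    induction h using Submodule.span_induction with
    | zero => rw [map_zero]; exact zero_mem _
    | add a b _ _ ha hb => rw [map_add]; exact add_mem ha hb
    | smul c a _ ha => rw [map_smul]; exact Submodule.smul_mem _ _ ha
    | mem y hy =>
      obtain ⟨v, hv, k, rfl | rfl⟩ := hy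
      · rcases Nat.eq_zero_or_pos k with rfl | hk
        · rw [pow_zero, mul_one]
          exact ih v hv
        · refine symmetrize_mul_mem hi hN ih (a := fun j => xForm j ^ k) (fun σ j => ?_)
            (fun j hj => pow_mem (xForm_mem hj) k) ?_ hv
          · rw [← formRep_xForm]
            exact map_pow (permAlg n σ) _ _
          · convert powerSum_mem (n := n) hk
            simp [xForm, powerSum, TensorProduct.sum_tmul]
      · refine symmetrize_mul_mem hi hN ih (a := fun j => xForm j ^ k * dForm j) (fun σ j => ?_)
          (fun j hj => mul_mem (pow_mem (xForm_mem hj) k) (dForm_mem hj)) ?_ hv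
        · rw [← formRep_xForm, ← formRep_dForm, formRep_mul]
          congr 1
          exact map_pow (permAlg n σ) _ _
        · convert powerForm_mem n k
          simp [xForm, dForm, powerForm]

/-- The augmentation of `Ωₙ`: the constant term of the degree `0` part. -/
def augmentation (n : ℕ) : Form n →ₐ[ℝ] ℝ :=
  Algebra.TensorProduct.lift (MvPolynomial.aeval 0) ExteriorAlgebra.algebraMapInv
    fun _ _ => Commute.all _ _

theorem augmentation_tmul {n : ℕ} (f : Poly n) (u : Grass n) :
    augmentation n (f ⊗ₜ u) = MvPolynomial.constantCoeff f * ExteriorAlgebra.algebraMapInv u := by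
  simp [augmentation]

theorem algebraMapInv_dx {n : ℕ} (i : Fin n) : ExteriorAlgebra.algebraMapInv (dx n i) = 0 := by
  simp [ExteriorAlgebra.algebraMapInv, dx]

theorem augmentation_powerIdeal {n : ℕ} {x : Form n} (hx : x ∈ powerIdeal n) :
    augmentation n x = 0 := by
  have : powerIdeal n ≤ RingHom.ker (augmentation n) := by
    rw [powerIdeal, Ideal.span_le]
    rintro _ (⟨k, hk, rfl⟩ | ⟨l, hl, rfl⟩)
    · rw [SetLike.mem_coe, RingHom.mem_ker, powerSum, augmentation_tmul, map_sum]
      have : k ≠ 0 := by rw [Finset.mem_Icc] at hk; omega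
      simp [this]
    · rw [SetLike.mem_coe, RingHom.mem_ker, powerForm, map_sum]
      simp [augmentation_tmul, algebraMapInv_dx]
  exact this hx

/-- An invariant without constant term is a multiple of its own symmetrization, hence lies in the
ideal generated by the power sums and their differentials. -/
theorem mem_powerIdeal_of_invariant {n : ℕ} {x : Form n} (h : ∀ σ, formRep n σ x = x)
    (h0 : augmentation n x = 0) : x ∈ powerIdeal n := by
  obtain ⟨y, hy, z, hz, hyz⟩ := Submodule.mem_sup.1 (symmetrize_mem x)
  obtain ⟨c, rfl⟩ := Submodule.mem_one.1 hy
  have h1 : symmetrize n x = (n.factorial : ℝ) • x := by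
    rw [symmetrize_apply]
    simp [h, Fintype.card_perm, Nat.cast_smul_eq_nsmul ℝ]
  have h2 := congrArg (augmentation n) hyz
  rw [map_add, augmentation_powerIdeal hz, h1, map_smul, h0, AlgHom.commutes] at h2
  simp only [Algebra.algebraMap_self, RingHom.id_apply, add_zero, smul_zero] at h2
  rw [h2, map_zero, zero_add, h1] at hyz
  have h3 : (n.factorial : ℝ) • x ∈ (powerIdeal n).restrictScalars ℝ := hyz ▸ hz
  exact (Submodule.smul_mem_iff _ (by exact_mod_cast n.factorial_ne_zero)).1 h3

theorem augmentation_of_mem_bidegree {n r s : ℕ} (h : 0 < r + s) {x : Form n}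
    (hx : x ∈ bidegree n r s) : augmentation n x = 0 := by
  have : bidegree n r s ≤ LinearMap.ker (augmentation n).toLinearMap := by
    rw [bidegree, Submodule.map₂_le]
    intro f hf u hu
    rw [LinearMap.mem_ker, TensorProduct.mk_apply, AlgHom.toLinearMap_apply, augmentation_tmul]
    rcases Nat.eq_zero_or_pos r with rfl | hr
    · obtain ⟨s, rfl⟩ : ∃ t, s = t + 1 := ⟨s - 1, by omega⟩
      have : ExteriorAlgebra.algebraMapInv u = 0 :=
        exteriorPower_succ_induction (C := fun u => ExteriorAlgebra.algebraMapInv u = 0)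
          (fun i v _ => by rw [map_mul, algebraMapInv_dx, zero_mul]) (map_zero _)
          (fun x y hx hy => by rw [map_add, hx, hy, add_zero]) hu
      rw [this, mul_zero]
    · rw [MvPolynomial.mem_homogeneousSubmodule] at hf
      rw [MvPolynomial.constantCoeff_eq, hf.coeff_eq_zero (by simpa using hr.ne), zero_mul]
  exact this hx

theorem mem_invariantIdeal_iff {n : ℕ} (x : Form n) :
    x ∈ invariantIdeal n ↔ x ∈ powerIdeal n := by
  constructor
  · have : invariantIdeal n ≤ (powerIdeal n).toTwoSided := by
      rw [invariantIdeal, TwoSidedIdeal.span_le]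
      rintro y ⟨hy, d, hd, hyd⟩
      rw [SetLike.mem_coe, Ideal.mem_toTwoSided]
      refine mem_powerIdeal_of_invariant hy ?_
      have : totalDegree n d ≤ LinearMap.ker (augmentation n).toLinearMap :=
        iSup_le fun p z hz => augmentation_of_mem_bidegree (by rw [p.2]; exact hd) hz
      exact this hyd
    intro hx
    exact Ideal.mem_toTwoSided.1 (this hx)
  · intro hx
    rw [← TwoSidedIdeal.mem_asIdeal]
    refine (Ideal.span_le.2 ?_ : powerIdeal n ≤ _) hx
    have hle (r s : ℕ) : bidegree n r s ≤ totalDegree n (r + s) :=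
      le_iSup (fun p : {p : ℕ × ℕ // p.1 + p.2 = r + s} => bidegree n p.1.1 p.1.2) ⟨(r, s), rfl⟩
    rintro _ (⟨k, hk, rfl⟩ | ⟨l, hl, rfl⟩)
    · rw [Finset.mem_Icc] at hk
      refine TwoSidedIdeal.subset_span ⟨formRep_powerSum k, k + 0, by omega, hle k 0 ?_⟩
      refine Submodule.apply_mem_map₂ (TensorProduct.mk ℝ (Poly n) (Grass n)) ?_ ?_
      · exact sum_mem fun i _ => MvPolynomial.isHomogeneous_X_pow i k
      · rw [ExteriorAlgebra.exteriorPower, pow_zero]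
        exact Submodule.one_le.1 le_rfl
    · refine TwoSidedIdeal.subset_span ⟨formRep_powerForm l, l + 1, by omega, hle l 1 ?_⟩
      refine sum_mem fun i _ => ?_
      refine Submodule.apply_mem_map₂ (TensorProduct.mk ℝ (Poly n) (Grass n)) ?_ ?_
      · exact MvPolynomial.isHomogeneous_X_pow i l
      · rw [ExteriorAlgebra.exteriorPower, pow_one]
        exact ⟨_, rfl⟩

theorem mem_harmonicForms {n : ℕ} {x : Form n} :
    x ∈ harmonicForms n ↔ ∀ y ∈ powerIdeal n, formInner n y x = 0 := by
  rw [harmonicForms, LinearMap.BilinForm.mem_orthogonal_iff]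
  refine forall_congr' fun y => ?_
  rw [Submodule.restrictScalars_mem, TwoSidedIdeal.mem_asIdeal, mem_invariantIdeal_iff]

theorem eq_zero_of_formInner {n : ℕ} {x : Form n} (h : ∀ y, formInner n y x = 0) : x = 0 :=
  formInner_self_eq_zero (h x)

theorem opD_eq_zero_of_harmonic {n k : ℕ} (hk : 1 ≤ k) {x : Form n} (hx : x ∈ harmonicForms n) :
    opD n k x = 0 := eq_zero_of_formInner fun y => by
  rw [← formInner_powerSum_mul]
  exact mem_harmonicForms.1 hx _ (Ideal.mul_mem_right _ _ (powerSum_mem hk))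

theorem opDelta_eq_zero_of_harmonic {n l : ℕ} {x : Form n} (hx : x ∈ harmonicForms n) :
    opDelta n l x = 0 := eq_zero_of_formInner fun y => by
  rw [← formInner_powerForm_mul]
  exact mem_harmonicForms.1 hx _ (Ideal.mul_mem_right _ _ (powerForm_mem n l))

/-- The generators of the ideal commute with every form up to sign, so orthogonality to the ideal
only has to be tested on right multiples of generators, where it is adjoint to annihilation by
the operators `D_k` and `δ_l`. -/
theorem harmonic_of_operators {n : ℕ} {x : Form n} (hD : ∀ k ∈ Finset.Icc 1 n, opD n k x = 0)
    (hd : ∀ l ∈ Finset.range n, opDelta n l x = 0) : x ∈ harmonicForms n := by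
  rw [mem_harmonicForms]
  intro y hy
  have h : ∀ w : Form n, formInner n (w * y) x = 0 := by
    rw [powerIdeal] at hy
    induction hy using Submodule.span_induction with
    | mem z hz =>
      intro w
      obtain ⟨k, hk, rfl⟩ | ⟨l, hl, rfl⟩ := hz
      · rw [mul_powerSum, formInner_powerSum_mul, hD k hk, map_zero]
      · rw [mul_powerForm, formInner_powerForm_mul, hd l hl, map_zero]
    | zero => simp
    | add a b _ _ ha hb => intro w; rw [mul_add, map_add, LinearMap.add_apply, ha, hb, add_zero]
    | smul c a _ ha => intro w; rw [smul_eq_mul, ← mul_assoc]; exact ha _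
  simpa using h 1


/-! ### The bigrading -/

theorem bidegree_fg (n r s : ℕ) : (bidegree n r s).FG :=
  Submodule.FG.map₂ _ (MvPolynomial.homogeneousSubmodule_fg _ _ r)
    ((Submodule.fg_top _).1 Module.Finite.fg_top)

theorem tmul_mem_bidegree {n r s : ℕ} {f : Poly n} (hf : f.IsHomogeneous r) {u : Grass n}
    (hu : u ∈ ⋀[ℝ]^s (Fin n → ℝ)) : f ⊗ₜ u ∈ bidegree n r s :=
  Submodule.apply_mem_map₂ (TensorProduct.mk ℝ (Poly n) (Grass n))
    ((MvPolynomial.mem_homogeneousSubmodule _ _).2 hf) hu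

theorem bidegree_induction {n r s : ℕ} {C : Form n → Prop}
    (tmul : ∀ f : Poly n, f.IsHomogeneous r → ∀ u ∈ ⋀[ℝ]^s (Fin n → ℝ), C (f ⊗ₜ u)) (zero : C 0)
    (add : ∀ x y, C x → C y → C (x + y)) {x : Form n} (hx : x ∈ bidegree n r s) : C x := by
  rw [bidegree, Submodule.map₂_eq_span_image2] at hx
  have h : ∀ c : ℝ, C (c • x) := by
    induction hx using Submodule.span_induction with
    | mem y hy =>
      obtain ⟨f, hf, u, hu, rfl⟩ := hy
      exact fun c => tmul (c • f) (Submodule.smul_mem _ c hf) u hu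
    | zero => intro c; rwa [smul_zero]
    | add x y _ _ hx hy => intro c; rw [smul_add]; exact add _ _ (hx c) (hy c)
    | smul c x _ hx => intro d; rw [smul_smul]; exact hx _
  simpa using h 1

/-- The projection onto the forms of bidegree `(r, s)`. -/
def bidegreeProj (n : ℕ) (p : ℕ × ℕ) : Module.End ℝ (Form n) :=
  TensorProduct.map (MvPolynomial.homogeneousComponent p.1)
    (GradedAlgebra.proj (fun i : ℕ => ⋀[ℝ]^i (Fin n → ℝ)) p.2)

theorem bidegreeProj_of_mem {n : ℕ} {p : ℕ × ℕ} {x : Form n} (hx : x ∈ bidegree n p.1 p.2) :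
    bidegreeProj n p x = x := by
  refine bidegree_induction (C := fun x => bidegreeProj n p x = x) (fun f hf u hu => ?_)
    (map_zero _) (fun x y hx hy => by rw [map_add, hx, hy]) hx
  rw [bidegreeProj, TensorProduct.map_tmul, MvPolynomial.homogeneousComponent_of_mem hf,
    if_pos rfl, GradedAlgebra.proj_apply,
    DirectSum.decompose_of_mem_same (fun i : ℕ => ⋀[ℝ]^i (Fin n → ℝ)) hu]

theorem bidegreeProj_of_mem_ne {n : ℕ} {p q : ℕ × ℕ} (hpq : q ≠ p) {x : Form n}
    (hx : x ∈ bidegree n q.1 q.2) : bidegreeProj n p x = 0 := by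
  refine bidegree_induction (C := fun x => bidegreeProj n p x = 0) (fun f hf u hu => ?_)
    (map_zero _) (fun x y hx hy => by rw [map_add, hx, hy, add_zero]) hx
  rw [bidegreeProj, TensorProduct.map_tmul, MvPolynomial.homogeneousComponent_of_mem hf,
    GradedAlgebra.proj_apply]
  by_cases h1 : q.1 = p.1
  · have h2 : q.2 ≠ p.2 := fun h2 => hpq (Prod.ext h1 h2)
    rw [DirectSum.decompose_of_mem_ne (fun i : ℕ => ⋀[ℝ]^i (Fin n → ℝ)) hu h2,
      TensorProduct.tmul_zero]
  · rw [if_neg (Ne.symm h1), TensorProduct.zero_tmul]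

theorem iSupIndep_bidegree (n : ℕ) : iSupIndep fun p : ℕ × ℕ => bidegree n p.1 p.2 := by
  intro p
  rw [Submodule.disjoint_def]
  intro x hx hx'
  rw [← bidegreeProj_of_mem hx]
  have : ⨆ q, ⨆ (_ : q ≠ p), bidegree n q.1 q.2 ≤ LinearMap.ker (bidegreeProj n p) :=
    iSup₂_le fun q hq y hy => bidegreeProj_of_mem_ne hq hy
  exact this hx'

theorem iSup_bidegree (n : ℕ) : ⨆ p : ℕ × ℕ, bidegree n p.1 p.2 = ⊤ := by
  rw [eq_top_iff]
  intro x hx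
  clear hx
  induction x using TensorProduct.induction_on with
  | zero => exact zero_mem _
  | add x y hx hy => exact add_mem hx hy
  | tmul f u =>
    rw [← MvPolynomial.sum_homogeneousComponent f, TensorProduct.sum_tmul]
    refine sum_mem fun r _ => ?_
    induction u using DirectSum.Decomposition.inductionOn fun i => ⋀[ℝ]^i (Fin n → ℝ) with
    | zero => simp
    | homogeneous m =>
      rename_i s
      exact Submodule.mem_iSup_of_mem (r, s) (tmul_mem_bidegree
        (MvPolynomial.homogeneousComponent_isHomogeneous r f) m.2)
    | add a b ha hb => rw [TensorProduct.tmul_add]; exact add_mem ha hb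

theorem exists_sum_bidegreeProj {n : ℕ} (x : Form n) : ∃ F : Finset (ℕ × ℕ),
    ∑ p ∈ F, bidegreeProj n p x = x ∧ ∀ p ∉ F, bidegreeProj n p x = 0 := by
  obtain ⟨y, hy, hyx⟩ := (Submodule.mem_iSup_iff_exists_finsupp _ x).1
    ((iSup_bidegree n).symm ▸ Submodule.mem_top : x ∈ ⨆ p : ℕ × ℕ, bidegree n p.1 p.2)
  have hproj : ∀ q, bidegreeProj n q x = y q := by
    intro q
    rw [← hyx, Finsupp.sum, map_sum, Finset.sum_eq_single q]
    · exact bidegreeProj_of_mem (hy q)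
    · exact fun q' _ h => bidegreeProj_of_mem_ne h (hy q')
    · intro h
      rw [Finsupp.notMem_support_iff.1 h, map_zero]
  refine ⟨y.support, ?_, fun p hp => ?_⟩
  · rw [Finset.sum_congr rfl fun p _ => hproj p]
    exact hyx
  · rw [hproj, Finsupp.notMem_support_iff.1 hp]

theorem bidegreeProj_mem (n : ℕ) (p : ℕ × ℕ) (x : Form n) :
    bidegreeProj n p x ∈ bidegree n p.1 p.2 := by
  induction x using TensorProduct.induction_on with
  | zero => simp
  | add x y hx hy => rw [map_add]; exact add_mem hx hy
  | tmul f u =>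
    exact tmul_mem_bidegree (MvPolynomial.homogeneousComponent_isHomogeneous _ f)
      (SetLike.coe_mem _)

/-- A homogeneous operator annihilates the bihomogeneous components of the forms that it
annihilates. -/
theorem apply_bidegreeProj_eq_zero {n k m : ℕ} {T : Module.End ℝ (Form n)}
    (hT : ∀ r s, ∀ x ∈ bidegree n (r + k) (s + m), T x ∈ bidegree n r s)
    (hT0 : ∀ r s, r < k ∨ s < m → ∀ x ∈ bidegree n r s, T x = 0) {x : Form n} (hx : T x = 0)
    (p : ℕ × ℕ) : T (bidegreeProj n p x) = 0 := by
  obtain ⟨F, hF, hF0⟩ := exists_sum_bidegreeProj x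
  by_cases hp : p.1 < k ∨ p.2 < m
  · exact hT0 _ _ hp _ (bidegreeProj_mem n p x)
  have h1 : ∀ q : ℕ × ℕ, ¬ (q.1 < k ∨ q.2 < m) →
      T (bidegreeProj n q x) ∈ bidegree n (q.1 - k) (q.2 - m) := by
    intro q hq
    apply hT
    rw [Nat.sub_add_cancel (by omega), Nat.sub_add_cancel (by omega)]
    exact bidegreeProj_mem n q x
  rw [← bidegreeProj_of_mem (p := (p.1 - k, p.2 - m)) (h1 p hp)]
  have h2 := congrArg (bidegreeProj n (p.1 - k, p.2 - m)) hx
  rw [← hF, map_sum, map_sum, map_zero, Finset.sum_eq_single p] at h2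
  · exact h2
  · intro q _ hq
    by_cases hq' : q.1 < k ∨ q.2 < m
    · rw [hT0 _ _ hq' _ (bidegreeProj_mem n q x), map_zero]
    · refine bidegreeProj_of_mem_ne (q := (q.1 - k, q.2 - m)) ?_ (h1 q hq')
      intro h
      apply hq
      rw [Prod.mk.injEq] at h
      exact Prod.ext (by omega) (by omega)
  · intro h
    rw [hF0 p h, map_zero, map_zero]

theorem partialPow_homogeneous {n : ℕ} (i : Fin n) : ∀ (k : ℕ) {r : ℕ} {f : Poly n},
    f.IsHomogeneous r → (partialPow n i k f).IsHomogeneous (r - k)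
  | 0, _, _, hf => hf
  | k + 1, r, f, hf => by
    rw [partialPow_succ, ← Nat.sub_sub]
    exact (partialPow_homogeneous i k hf).pderiv

theorem partialPow_eq_zero {n : ℕ} (i : Fin n) {k r : ℕ} (h : r < k) {f : Poly n}
    (hf : f.IsHomogeneous r) : partialPow n i k f = 0 := by
  obtain ⟨k, rfl⟩ : ∃ m, k = m + 1 := ⟨k - 1, by omega⟩
  have h1 := partialPow_homogeneous i k hf
  rw [Nat.sub_eq_zero_of_le (by omega)] at h1
  rw [← MvPolynomial.totalDegree_zero_iff_isHomogeneous,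
    MvPolynomial.totalDegree_eq_zero_iff_eq_C] at h1
  rw [partialPow_succ, h1, MvPolynomial.pderiv_C]

/-- The subtraction is truncated, which is harmless: for `r < k` the form `D_k x` is zero. -/
theorem opD_mem {n k r s : ℕ} {x : Form n} (hx : x ∈ bidegree n r s) :
    opD n k x ∈ bidegree n (r - k) s := by
  refine bidegree_induction (C := fun x => opD n k x ∈ bidegree n (r - k) s) (fun f hf u hu => ?_)
    (by simp) (fun x y hx hy => by rw [map_add]; exact add_mem hx hy) hx
  rw [opD_eq, sumOp_tmul]
  exact sum_mem fun i _ => tmul_mem_bidegree (partialPow_homogeneous i k hf) hu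

theorem opD_eq_zero {n k r s : ℕ} (h : r < k) {x : Form n} (hx : x ∈ bidegree n r s) :
    opD n k x = 0 := by
  refine bidegree_induction (C := fun x => opD n k x = 0) (fun f hf u hu => ?_)
    (by simp) (fun x y hx hy => by rw [map_add, hx, hy, add_zero]) hx
  rw [opD_eq, sumOp_tmul]
  exact Finset.sum_eq_zero fun i _ => by rw [partialPow_eq_zero i h hf, TensorProduct.zero_tmul]

theorem opDelta_mem {n l r s : ℕ} {x : Form n} (hx : x ∈ bidegree n r (s + 1)) :
    opDelta n l x ∈ bidegree n (r - l) s := by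
  refine bidegree_induction (C := fun x => opDelta n l x ∈ bidegree n (r - l) s)
    (fun f hf u hu => ?_) (by simp) (fun x y hx hy => by rw [map_add]; exact add_mem hx hy) hx
  rw [opDelta_eq, sumOp_tmul]
  exact sum_mem fun i _ => tmul_mem_bidegree (partialPow_homogeneous i l hf) (contract_mem i hu)

theorem opDelta_eq_zero {n l r s : ℕ} (h : r < l ∨ s < 1) {x : Form n} (hx : x ∈ bidegree n r s) :
    opDelta n l x = 0 := by
  refine bidegree_induction (C := fun x => opDelta n l x = 0) (fun f hf u hu => ?_)
    (by simp) (fun x y hx hy => by rw [map_add, hx, hy, add_zero]) hx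
  rw [opDelta_eq, sumOp_tmul]
  refine Finset.sum_eq_zero fun i _ => ?_
  rcases h with h | h
  · rw [partialPow_eq_zero i h hf, TensorProduct.zero_tmul]
  · obtain rfl : s = 0 := by omega
    rw [contract_mem_zero i hu, TensorProduct.tmul_zero]

theorem opd_mem {n l r s : ℕ} {x : Form n} (hx : x ∈ bidegree n r s) :
    opd n l x ∈ bidegree n (r - l) (s + 1) := by
  refine bidegree_induction (C := fun x => opd n l x ∈ bidegree n (r - l) (s + 1))
    (fun f hf u hu => ?_) (by simp) (fun x y hx hy => by rw [map_add]; exact add_mem hx hy) hx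
  rw [opd, sumOp_tmul]
  exact sum_mem fun i _ => tmul_mem_bidegree (partialPow_homogeneous i l hf) (dx_mul_mem i hu)

theorem fieldContract_mem {n l r s : ℕ} {x : Form n} (hx : x ∈ bidegree n r (s + 1)) :
    fieldContract n l x ∈ bidegree n (l + r) s := by
  refine bidegree_induction (C := fun x => fieldContract n l x ∈ bidegree n (l + r) s)
    (fun f hf u hu => ?_) (by simp) (fun x y hx hy => by rw [map_add]; exact add_mem hx hy) hx
  rw [fieldContract, sumOp_tmul]
  exact sum_mem fun i _ => tmul_mem_bidegree ((MvPolynomial.isHomogeneous_X_pow i l).mul hf)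
    (contract_mem i hu)

/-- The components of a harmonic form are harmonic, as the operators cutting out the harmonic
forms are bihomogeneous. -/
theorem bidegreeProj_harmonic {n : ℕ} {x : Form n} (hx : x ∈ harmonicForms n) (p : ℕ × ℕ) :
    bidegreeProj n p x ∈ harmonicForms n := by
  refine harmonic_of_operators (fun k hk => ?_) fun l _ => ?_
  · refine apply_bidegreeProj_eq_zero (k := k) (m := 0) (fun r s y hy => ?_)
      (fun r s h y hy => opD_eq_zero (by simpa using h) hy)
      (opD_eq_zero_of_harmonic (Finset.mem_Icc.1 hk).1 hx) p
    simpa using opD_mem (k := k) hy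
  · refine apply_bidegreeProj_eq_zero (k := l) (m := 1) (fun r s y hy => ?_)
      (fun r s h y hy => opDelta_eq_zero h hy) (opDelta_eq_zero_of_harmonic hx) p
    simpa using opDelta_mem (l := l) hy

theorem iSup_harmonicPart (n : ℕ) :
    ⨆ p : ℕ × ℕ, harmonicPart n p.1 p.2 = harmonicForms n := by
  refine le_antisymm (iSup_le fun p => inf_le_left) fun x hx => ?_
  obtain ⟨F, hF, -⟩ := exists_sum_bidegreeProj x
  rw [← hF]
  exact sum_mem fun p _ => Submodule.mem_iSup_of_mem p
    ⟨bidegreeProj_harmonic hx p, bidegreeProj_mem n p x⟩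


/-! ### Alternating polynomials -/

/-- The Vandermonde determinant `∏_{i<j} (xⱼ - xᵢ)`. -/
def vandermonde (n : ℕ) : Poly n :=
  (Matrix.vandermonde fun i : Fin n => (MvPolynomial.X i : Poly n)).det

theorem vandermonde_eq (n : ℕ) : vandermonde n =
    ∏ p ∈ (Finset.univ : Finset (Fin n)).sigma fun i => Finset.Ioi i,
      (MvPolynomial.X p.2 - MvPolynomial.X p.1) := by
  rw [vandermonde, Matrix.det_vandermonde, Finset.prod_sigma]

theorem vandermonde_ne_zero (n : ℕ) : vandermonde n ≠ 0 :=
  Matrix.det_vandermonde_ne_zero_iff.2 (MvPolynomial.X_injective (R := ℝ))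

theorem rename_vandermonde {n : ℕ} (σ : Equiv.Perm (Fin n)) :
    MvPolynomial.rename σ (vandermonde n) = ((Equiv.Perm.sign σ : ℤ) : ℝ) • vandermonde n := by
  rw [vandermonde, AlgHom.map_det]
  have : (MvPolynomial.rename σ).mapMatrix
      (Matrix.vandermonde fun i : Fin n => (MvPolynomial.X i : Poly n)) =
      (Matrix.vandermonde fun i : Fin n => (MvPolynomial.X i : Poly n)).submatrix σ id := by
    ext i j : 2
    simp [Matrix.vandermonde_apply]
  rw [this, Matrix.det_permute, Int.cast_smul_eq_zsmul, zsmul_eq_mul]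

theorem vandermonde_homogeneous (n : ℕ) :
    (vandermonde n).IsHomogeneous (∑ i : Fin n, (i : ℕ)) := by
  have h : ∑ p ∈ (Finset.univ : Finset (Fin n)).sigma fun i => Finset.Ioi i, 1 =
      ∑ i : Fin n, (i : ℕ) := by
    rw [Finset.sum_sigma, ← Equiv.sum_comp Fin.revPerm]
    refine Finset.sum_congr rfl fun i _ => ?_
    rw [Finset.sum_const, smul_eq_mul, mul_one, Fin.card_Ioi, Fin.revPerm_apply, Fin.val_rev]
    omega
  rw [vandermonde_eq, ← h]
  exact MvPolynomial.IsHomogeneous.prod _ _ _ fun p _ =>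
    (MvPolynomial.isHomogeneous_X ℝ _).sub (MvPolynomial.isHomogeneous_X ℝ _)

/-- The substitution of `xⱼ` for `xᵢ`. -/
def identify {n : ℕ} (i j : Fin n) : Poly n →ₐ[ℝ] Poly n :=
  MvPolynomial.aeval fun k => if k = i then MvPolynomial.X j else MvPolynomial.X k

/-- Modulo `xⱼ - xᵢ`, substituting `xⱼ` for `xᵢ` changes nothing. -/
theorem X_sub_X_dvd_iff {n : ℕ} (i j : Fin n) (f : Poly n) :
    (MvPolynomial.X j - MvPolynomial.X i) ∣ f ↔ identify i j f = 0 := by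
  constructor
  · rintro ⟨g, rfl⟩
    have : identify i j (MvPolynomial.X j - MvPolynomial.X i) = 0 := by
      simp only [identify, map_sub, MvPolynomial.aeval_X, if_true]
      split_ifs <;> exact sub_self _
    rw [map_mul, this, zero_mul]
  · intro h
    let I : Ideal (Poly n) := Ideal.span {MvPolynomial.X j - MvPolynomial.X i}
    have key : (Ideal.Quotient.mkₐ ℝ I).comp (identify i j) = Ideal.Quotient.mkₐ ℝ I := by
      refine MvPolynomial.algHom_ext fun k => ?_
      rw [AlgHom.comp_apply, identify, MvPolynomial.aeval_X]
      split_ifs with hk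
      · rw [hk, Ideal.Quotient.mkₐ_eq_mk, Ideal.Quotient.eq]
        exact Ideal.subset_span rfl
      · rfl
    have h1 := congrArg (fun φ => φ f) key
    simp only [AlgHom.comp_apply, h, map_zero] at h1
    rw [Ideal.Quotient.mkₐ_eq_mk, eq_comm, Ideal.Quotient.eq_zero_iff_mem] at h1
    exact Ideal.mem_span_singleton.1 h1

theorem prime_X_sub_X {n : ℕ} {i j : Fin n} (h : i ≠ j) :
    Prime (MvPolynomial.X j - MvPolynomial.X i : Poly n) := by
  refine ⟨fun h0 => h ?_, fun hu => ?_, fun f g hfg => ?_⟩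
  · exact (MvPolynomial.X_injective (R := ℝ) (sub_eq_zero.1 h0)).symm
  · have h1 := (X_sub_X_dvd_iff i j (1 : Poly n)).1 hu.dvd
    rw [map_one] at h1
    exact one_ne_zero h1
  · rw [X_sub_X_dvd_iff, map_mul, mul_eq_zero] at hfg
    rwa [X_sub_X_dvd_iff, X_sub_X_dvd_iff]

/-- Alternating polynomials are the multiples of the Vandermonde determinant by symmetric
polynomials. -/
theorem exists_eq_vandermonde_mul {n : ℕ} {f : Poly n}
    (hf : ∀ σ : Equiv.Perm (Fin n), MvPolynomial.rename σ f = ((Equiv.Perm.sign σ : ℤ) : ℝ) • f) :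
    ∃ g : Poly n, f = vandermonde n * g ∧
      ∀ σ : Equiv.Perm (Fin n), MvPolynomial.rename σ g = g := by
  have hdvd : vandermonde n ∣ f := by
    rw [vandermonde_eq]
    refine Finset.prod_dvd_of_isRelPrime ?_ fun p hp => ?_
    · rintro ⟨i, j⟩ hij ⟨k, l⟩ hkl hne
      simp only [Finset.coe_sigma, Set.mem_sigma_iff, Finset.mem_coe, Finset.mem_univ, true_and,
        Finset.mem_Ioi] at hij hkl
      refine ((prime_X_sub_X hij.ne).irreducible.isRelPrime_iff_not_dvd).2 fun hd => ?_
      rw [X_sub_X_dvd_iff, identify, map_sub, MvPolynomial.aeval_X, MvPolynomial.aeval_X,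
        sub_eq_zero] at hd
      have hX := MvPolynomial.X_injective (σ := Fin n) (R := ℝ)
      split_ifs at hd with h1 h2 h2
      · exact hkl.ne (h2.trans h1.symm)
      · have := hX hd
        subst h1 this
        exact absurd hij hkl.asymm
      · have := hX hd
        subst h2 this
        exact hne rfl
      · exact hkl.ne (hX hd).symm
    · rw [Finset.mem_sigma, Finset.mem_Ioi] at hp
      rw [X_sub_X_dvd_iff]
      have h1 : (identify p.1 p.2).comp (MvPolynomial.rename (Equiv.swap p.1 p.2)) =
          identify p.1 p.2 := by
        refine MvPolynomial.algHom_ext fun k => ?_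
        rw [AlgHom.comp_apply, MvPolynomial.rename_X, identify, MvPolynomial.aeval_X,
          MvPolynomial.aeval_X]
        rcases eq_or_ne k p.1 with rfl | hk1
        · simp [hp.2.ne']
        · rcases eq_or_ne k p.2 with rfl | hk2
          · simp [hp.2.ne']
          · rw [Equiv.swap_apply_of_ne_of_ne hk1 hk2]
      have h2 := congrArg (fun φ => φ f) h1
      simp only [AlgHom.comp_apply, hf, map_smul, Equiv.Perm.sign_swap hp.2.ne] at h2
      simp only [Units.val_neg, Units.val_one, Int.cast_neg, Int.cast_one, neg_smul, one_smul] at h2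
      exact self_eq_neg.1 h2.symm
  obtain ⟨g, rfl⟩ := hdvd
  refine ⟨g, rfl, fun σ => ?_⟩
  have h1 := hf σ
  rw [map_mul, rename_vandermonde, smul_mul_assoc] at h1
  have h2 : ((Equiv.Perm.sign σ : ℤ) : ℝ) ≠ 0 := by simp
  exact mul_left_cancel₀ (vandermonde_ne_zero n) (smul_right_injective _ h2 h1)

/-- A nonzero alternating polynomial has at least the degree of the Vandermonde determinant. -/
theorem eq_zero_of_alternating {n m : ℕ} {f : Poly n}
    (hf : ∀ σ : Equiv.Perm (Fin n), MvPolynomial.rename σ f = ((Equiv.Perm.sign σ : ℤ) : ℝ) • f)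
    (hm : f.IsHomogeneous m) (h : m < ∑ i : Fin n, (i : ℕ)) : f = 0 := by
  by_contra h0
  obtain ⟨g, rfl, -⟩ := exists_eq_vandermonde_mul hf
  have h1 := hm.totalDegree h0
  rw [MvPolynomial.totalDegree_mul_of_isDomain (left_ne_zero_of_mul h0) (right_ne_zero_of_mul h0),
    (vandermonde_homogeneous n).totalDegree (vandermonde_ne_zero n)] at h1
  omega

theorem exists_eq_C_mul_vandermonde {n : ℕ} {f : Poly n}
    (hf : ∀ σ : Equiv.Perm (Fin n), MvPolynomial.rename σ f = ((Equiv.Perm.sign σ : ℤ) : ℝ) • f)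
    (hm : f.IsHomogeneous (∑ i : Fin n, (i : ℕ))) :
    ∃ c : ℝ, f = MvPolynomial.C c * vandermonde n := by
  by_cases h0 : f = 0
  · exact ⟨0, by simp [h0]⟩
  obtain ⟨g, rfl, -⟩ := exists_eq_vandermonde_mul hf
  have h1 := hm.totalDegree h0
  rw [MvPolynomial.totalDegree_mul_of_isDomain (left_ne_zero_of_mul h0) (right_ne_zero_of_mul h0),
    (vandermonde_homogeneous n).totalDegree (vandermonde_ne_zero n)] at h1
  have h2 := MvPolynomial.totalDegree_eq_zero_iff_eq_C.1 (Nat.add_eq_left.1 h1)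
  exact ⟨_, by rw [h2]; exact mul_comm _ _⟩

/-! ### Functions as forms -/

theorem tmul_one_injective {n : ℕ} {f g : Poly n} (h : f ⊗ₜ[ℝ] (1 : Grass n) = g ⊗ₜ 1) : f = g := by
  have := congrArg (TensorProduct.rid ℝ (Poly n) ∘
    TensorProduct.map LinearMap.id
      (ExteriorAlgebra.algebraMapInv (R := ℝ) (M := Fin n → ℝ)).toLinearMap) h
  simpa using this

/-- The `s`-forms with polynomial coefficients. -/
def sForms (n s : ℕ) : Submodule ℝ (Form n) :=
  Submodule.map₂ (TensorProduct.mk ℝ (Poly n) (Grass n)) ⊤ (⋀[ℝ]^s (Fin n → ℝ))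

theorem tmul_mem_sForms {n s : ℕ} (f : Poly n) {u : Grass n}
    (hu : u ∈ ⋀[ℝ]^s (Fin n → ℝ)) : f ⊗ₜ u ∈ sForms n s :=
  Submodule.apply_mem_map₂ (TensorProduct.mk ℝ (Poly n) (Grass n)) Submodule.mem_top hu

theorem bidegree_le_sForms (n r s : ℕ) : bidegree n r s ≤ sForms n s :=
  Submodule.map₂_le_map₂ le_top le_rfl

theorem sForms_induction {n s : ℕ} {C : Form n → Prop}
    (tmul : ∀ f : Poly n, ∀ u ∈ ⋀[ℝ]^s (Fin n → ℝ), C (f ⊗ₜ u)) (zero : C 0)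
    (add : ∀ x y, C x → C y → C (x + y)) {x : Form n} (hx : x ∈ sForms n s) : C x := by
  rw [sForms, Submodule.map₂_eq_span_image2] at hx
  have h : ∀ c : ℝ, C (c • x) := by
    induction hx using Submodule.span_induction with
    | mem y hy =>
      obtain ⟨f, hf, u, hu, rfl⟩ := hy
      exact fun c => tmul (c • f) u hu
    | zero => intro c; rwa [smul_zero]
    | add x y _ _ hx hy => intro c; rw [smul_add]; exact add _ _ (hx c) (hy c)
    | smul c x _ hx => intro d; rw [smul_smul]; exact hx _
  simpa using h 1

theorem smul_mem_sForms {n s : ℕ} (g : Poly n) {x : Form n} (hx : x ∈ sForms n s) :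
    g • x ∈ sForms n s := by
  refine sForms_induction (C := fun x => g • x ∈ sForms n s) (fun f u hu => ?_) (by simp)
    (fun x y hx hy => by rw [smul_add]; exact add_mem hx hy) hx
  rw [TensorProduct.smul_tmul']
  exact tmul_mem_sForms _ hu

theorem fieldContract_mem_sForms {n l s : ℕ} {x : Form n} (hx : x ∈ sForms n (s + 1)) :
    fieldContract n l x ∈ sForms n s := by
  refine sForms_induction (C := fun x => fieldContract n l x ∈ sForms n s)
    (fun f u hu => ?_) (by simp) (fun x y hx hy => by rw [map_add]; exact add_mem hx hy) hx
  rw [fieldContract, sumOp_tmul]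
  exact sum_mem fun i _ => tmul_mem_sForms _ (contract_mem i hu)

theorem exists_eq_tmul_one {n : ℕ} {x : Form n} (hx : x ∈ sForms n 0) :
    ∃ f : Poly n, x = f ⊗ₜ 1 := by
  refine sForms_induction (C := fun x => ∃ f : Poly n, x = f ⊗ₜ 1) (fun f u hu => ?_)
    ⟨0, by simp⟩ ?_ hx
  · rw [ExteriorAlgebra.exteriorPower, pow_zero, Submodule.mem_one] at hu
    obtain ⟨c, rfl⟩ := hu
    exact ⟨c • f, by rw [Algebra.algebraMap_eq_smul_one, TensorProduct.tmul_smul]; rfl⟩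
  · rintro _ _ ⟨f, rfl⟩ ⟨g, rfl⟩
    exact ⟨f + g, (TensorProduct.add_tmul _ _ _).symm⟩

theorem exists_homogeneous_eq_tmul_one {n r : ℕ} {x : Form n} (hx : x ∈ bidegree n r 0) :
    ∃ f : Poly n, f.IsHomogeneous r ∧ x = f ⊗ₜ 1 := by
  refine bidegree_induction (C := fun x => ∃ f : Poly n, f.IsHomogeneous r ∧ x = f ⊗ₜ 1)
    (fun f hf u hu => ?_) ⟨0, MvPolynomial.isHomogeneous_zero _ _ _, by simp⟩ ?_ hx
  · rw [ExteriorAlgebra.exteriorPower, pow_zero, Submodule.mem_one] at hu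
    obtain ⟨c, rfl⟩ := hu
    refine ⟨c • f, Submodule.smul_mem (MvPolynomial.homogeneousSubmodule _ _ r) c hf, ?_⟩
    rw [Algebra.algebraMap_eq_smul_one, TensorProduct.tmul_smul]
    rfl
  · rintro _ _ ⟨f, hf, rfl⟩ ⟨g, hg, rfl⟩
    exact ⟨f + g, hf.add hg, (TensorProduct.add_tmul _ _ _).symm⟩

theorem rename_of_tmul_one_mem {n : ℕ} {f : Poly n} (hf : f ⊗ₜ 1 ∈ signForms n)
    (σ : Equiv.Perm (Fin n)) :
    MvPolynomial.rename σ f = ((Equiv.Perm.sign σ : ℤ) : ℝ) • f := by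
  have h := hf σ
  rw [formRep_tmul, map_one, TensorProduct.smul_tmul'] at h
  exact tmul_one_injective h

/-! ### The invariant vector fields separate forms -/

theorem smul_form_eq_zero {n : ℕ} {f : Poly n} (hf : f ≠ 0) {x : Form n} (h : f • x = 0) :
    x = 0 := by
  let b := (grassBasis n).baseChange (Poly n)
  apply b.repr.injective
  ext S : 1
  have h1 := congrArg (fun y => b.repr y S) h
  simp only [map_smul, map_zero, Finsupp.smul_apply, Finsupp.zero_apply, smul_eq_mul] at h1
  simpa using (mul_eq_zero.1 h1).resolve_left hf

/-- The contraction with the coordinate vector field `∂ⱼ`. -/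
def coordContract (n : ℕ) (j : Fin n) : Module.End ℝ (Form n) :=
  TensorProduct.map LinearMap.id (contract n j)

theorem fieldContract_apply {n : ℕ} (l : ℕ) (x : Form n) :
    fieldContract n l x = ∑ j, (MvPolynomial.X j : Poly n) ^ l • coordContract n j x := by
  induction x using TensorProduct.induction_on with
  | zero => simp
  | add x y hx hy => simp only [map_add, smul_add, Finset.sum_add_distrib, hx, hy]
  | tmul f u => simp [fieldContract, sumOp_tmul, coordContract, TensorProduct.smul_tmul']

/-- Cramer's rule: the coordinate fields are combinations of the invariant vector fields, up to
the Vandermonde determinant. -/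
theorem coordContract_eq_zero {n : ℕ} {x : Form n} (h : ∀ l : Fin n, fieldContract n l x = 0)
    (k : Fin n) : coordContract n k x = 0 := by
  refine smul_form_eq_zero (vandermonde_ne_zero n) ?_
  set V := Matrix.vandermonde fun i : Fin n => (MvPolynomial.X i : Poly n) with hV
  have h1 : ∑ l, V.adjugate l k • fieldContract n l x = 0 := by simp [h]
  simp only [fieldContract_apply, Finset.smul_sum, smul_smul] at h1
  rw [Finset.sum_comm] at h1
  simp only [← Finset.sum_smul] at h1
  have h2 : ∀ j, ∑ l : Fin n, V.adjugate l k * (MvPolynomial.X j : Poly n) ^ (l : ℕ) =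
      if j = k then vandermonde n else 0 := by
    intro j
    have := congrArg (fun M => M j k) V.mul_adjugate
    simp only [Matrix.mul_apply, Matrix.smul_apply, Matrix.one_apply, smul_eq_mul, mul_ite, mul_one,
      mul_zero] at this
    rw [vandermonde, ← hV, ← this]
    exact Finset.sum_congr rfl fun l _ => by rw [mul_comm, hV, Matrix.vandermonde_apply]
  simpa [h2] using h1

theorem formInner_tmul_dx_mul {n : ℕ} (f : Poly n) (j : Fin n) (u : Grass n) (x : Form n) :
    formInner n (f ⊗ₜ (dx n j * u)) x = formInner n (f ⊗ₜ u) (coordContract n j x) := by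
  induction x using TensorProduct.induction_on with
  | zero => simp
  | add x y hx hy => simp only [map_add, hx, hy]
  | tmul g v => simp [formInner_tmul, coordContract, grassInner_dx_mul]

/-- Contraction with all coordinate fields is adjoint to multiplication by all `dxⱼ`, and forms of
positive degree are combinations of multiples of the `dxⱼ`. -/
theorem eq_zero_of_fieldContract {n s : ℕ} {x : Form n} (hx : x ∈ sForms n (s + 1))
    (h : ∀ l : Fin n, fieldContract n l x = 0) : x = 0 := by
  refine formInner_self_eq_zero ?_
  refine sForms_induction (C := fun y => formInner n y x = 0) (fun f u hu => ?_) (by simp)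
    (fun y z hy hz => by rw [map_add, LinearMap.add_apply, hy, hz, add_zero]) hx
  refine exteriorPower_succ_induction (C := fun u => formInner n (f ⊗ₜ u) x = 0)
    (fun i v _ => ?_) (by simp) (fun y z hy hz => by
      rw [TensorProduct.tmul_add, map_add, LinearMap.add_apply, hy, hz, add_zero]) hu
  rw [formInner_tmul_dx_mul, coordContract_eq_zero h, map_zero]

theorem grassHom_insert {n : ℕ} {T : Fin n → Module.End ℝ (Form n)}
    (h : ∀ i j, T i * T j + T j * T i = 0) {i : Fin n} {S : Finset (Fin n)} (hi : i ∉ S) :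
    ∃ e : ℝ, e * e = 1 ∧ ∀ x, grassHom T h (grassBasis n (insert i S)) x =
      e • T i (grassHom T h (grassBasis n S) x) := by
  obtain ⟨e, he, h1⟩ := dx_mul_grassBasis hi
  refine ⟨e, he, fun x => ?_⟩
  rw [eq_smul_of_eq_smul he h1, map_smul, map_mul, grassHom_dx]
  rfl

/-- The iterated contraction with the invariant vector fields indexed by `S`. -/
def fieldOp {n : ℕ} (S : Finset (Fin n)) : Module.End ℝ (Form n) := fieldHom n (grassBasis n S)

theorem fieldOp_empty {n : ℕ} (x : Form n) : fieldOp ∅ x = x := by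
  rw [fieldOp, grassBasis_empty, map_one]
  rfl

theorem fieldOp_insert {n : ℕ} {i : Fin n} {S : Finset (Fin n)} (hi : i ∉ S) :
    ∃ e : ℝ, e * e = 1 ∧ ∀ x, fieldOp (insert i S) x = e • fieldContract n i (fieldOp S x) :=
  grassHom_insert _ hi

theorem fieldOp_smul {n : ℕ} (S : Finset (Fin n)) (f : Poly n) (x : Form n) :
    fieldOp S (f • x) = f • fieldOp S x := by
  induction S using Finset.induction with
  | empty => rw [fieldOp_empty, fieldOp_empty]
  | insert i S hi ih =>
    obtain ⟨e, -, he⟩ := fieldOp_insert hi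
    rw [he, he, ih, fieldContract_smul, smul_comm]

theorem formRep_fieldOp {n : ℕ} (S : Finset (Fin n)) (σ : Equiv.Perm (Fin n)) (x : Form n) :
    formRep n σ (fieldOp S x) = fieldOp S (formRep n σ x) := by
  induction S using Finset.induction with
  | empty => rw [fieldOp_empty, fieldOp_empty]
  | insert i S hi ih =>
    obtain ⟨e, -, he⟩ := fieldOp_insert hi
    rw [he, he, map_smul, formRep_fieldContract, ih]

theorem fieldOp_mem_signForms {n : ℕ} (S : Finset (Fin n)) {x : Form n} (hx : x ∈ signForms n) :
    fieldOp S x ∈ signForms n := by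
  intro σ
  rw [formRep_fieldOp, hx σ, map_smul]

theorem fieldOp_mem_sForms {n : ℕ} (S : Finset (Fin n)) : ∀ {s : ℕ} {x : Form n},
    x ∈ sForms n (s + S.card) → fieldOp S x ∈ sForms n s := by
  induction S using Finset.induction with
  | empty => intro s x hx; rwa [fieldOp_empty]
  | insert i S hi ih =>
    intro s x hx
    obtain ⟨e, -, he⟩ := fieldOp_insert hi
    rw [Finset.card_insert_of_notMem hi, add_comm S.card, ← add_assoc] at hx
    rw [he]
    exact Submodule.smul_mem _ _ (fieldContract_mem_sForms (ih hx))

theorem fieldOp_mem {n r : ℕ} (S : Finset (Fin n)) : ∀ {s : ℕ} {x : Form n},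
    x ∈ bidegree n r (s + S.card) → fieldOp S x ∈ bidegree n (∑ i ∈ S, (i : ℕ) + r) s := by
  induction S using Finset.induction with
  | empty => intro s x hx; rw [fieldOp_empty]; simpa using hx
  | insert i S hi ih =>
    intro s x hx
    obtain ⟨e, -, he⟩ := fieldOp_insert hi
    rw [Finset.card_insert_of_notMem hi, add_comm S.card, ← add_assoc] at hx
    rw [he, Finset.sum_insert hi, add_assoc]
    exact Submodule.smul_mem _ _ (fieldContract_mem (ih hx))

theorem fieldOp_fieldOp_of_not_disjoint {n : ℕ} {S T : Finset (Fin n)} (h : ¬ Disjoint S T)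
    (x : Form n) : fieldOp S (fieldOp T x) = 0 := by
  rw [fieldOp, fieldOp, ← Module.End.mul_apply, ← map_mul, grassBasis_mul_of_not_disjoint h,
    map_zero, LinearMap.zero_apply]

theorem fieldOp_fieldOp_of_disjoint {n : ℕ} {S T : Finset (Fin n)} (h : Disjoint S T) :
    ∃ e : ℝ, e * e = 1 ∧ ∀ x, fieldOp S (fieldOp T x) = e • fieldOp (S ∪ T) x := by
  obtain ⟨e, he, h1⟩ := grassBasis_mul_of_disjoint h
  refine ⟨e, he, fun x => ?_⟩
  rw [fieldOp, fieldOp, ← Module.End.mul_apply, ← map_mul, h1, map_smul]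
  rfl

theorem fieldOp_singleton {n : ℕ} (l : Fin n) (x : Form n) :
    fieldOp {l} x = fieldContract n l x := by
  rw [fieldOp, grassBasis_singleton, fieldHom, grassHom_dx]

/-- An `s`-form is determined by its contractions with `s` invariant vector fields, since these
fields are linearly independent over the rational functions. -/
theorem eq_zero_of_fieldOp {n : ℕ} : ∀ {s : ℕ} {x : Form n}, x ∈ sForms n s →
    (∀ S : Finset (Fin n), S.card = s → fieldOp S x = 0) → x = 0
  | 0, x, _, h => by simpa [fieldOp_empty] using h ∅ rfl
  | s + 1, x, hx, h => by
    refine eq_zero_of_fieldContract hx fun l => ?_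
    refine eq_zero_of_fieldOp (s := s) (fieldContract_mem_sForms hx) fun S hS => ?_
    rw [← fieldOp_singleton]
    by_cases hl : l ∈ S
    · exact fieldOp_fieldOp_of_not_disjoint (by simpa using hl) x
    · obtain ⟨e, _, he⟩ := fieldOp_fieldOp_of_disjoint (S := S) (T := {l}) (by simpa using hl)
      rw [he, h _ (by rw [Finset.card_union_of_disjoint (by simpa using hl), hS,
        Finset.card_singleton]), smul_zero]

/-! ### The fundamental alternant -/

/-- The volume form `dx_1 ∧ ⋯ ∧ dx_n`. -/
def volumeForm (n : ℕ) : Form n := 1 ⊗ₜ grassBasis n Finset.univ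

theorem volumeForm_mem_signForms (n : ℕ) : volumeForm n ∈ signForms n := by
  intro σ
  rw [volumeForm, formRep_tmul, map_one, map_grassBasis_univ, TensorProduct.tmul_smul]

theorem volumeForm_mem (n : ℕ) : volumeForm n ∈ bidegree n 0 n := by
  have := grassBasis_mem (Finset.univ : Finset (Fin n))
  rw [Finset.card_fin] at this
  exact tmul_mem_bidegree (MvPolynomial.isHomogeneous_one _ _) this

theorem volumeForm_ne_zero (n : ℕ) : volumeForm n ≠ 0 := by
  intro h
  have h1 : formInner n (volumeForm n) (volumeForm n) = 1 := by
    rw [volumeForm, formInner_tmul, grassInner_grassBasis, if_pos rfl,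
      show (1 : Poly n) = MvPolynomial.monomial 0 1 from rfl, polyInner_monomial_monomial]
    simp
  rw [h, map_zero] at h1
  simp at h1

/-- The contraction of the volume form with all invariant vector fields, a multiple of the
Vandermonde determinant. -/
def topAlternant (n : ℕ) : Form n := fieldOp Finset.univ (volumeForm n)

theorem topAlternant_mem_signForms (n : ℕ) : topAlternant n ∈ signForms n :=
  fieldOp_mem_signForms _ (volumeForm_mem_signForms n)

theorem topAlternant_mem (n : ℕ) : topAlternant n ∈ bidegree n (∑ i : Fin n, (i : ℕ)) 0 := by
  have := fieldOp_mem (r := 0) (s := 0) (x := volumeForm n) (Finset.univ : Finset (Fin n))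
  rw [Finset.card_fin, zero_add] at this
  exact this (volumeForm_mem n)

theorem topAlternant_ne_zero (n : ℕ) : topAlternant n ≠ 0 := fun h =>
  volumeForm_ne_zero n <| eq_zero_of_fieldOp (bidegree_le_sForms n 0 n (volumeForm_mem n))
    fun S hS => by rwa [Finset.eq_univ_of_card S (by rw [hS, Fintype.card_fin])]

/-- Alternating functions are the symmetric multiples of the fundamental alternant. -/
theorem exists_eq_smul_topAlternant {n : ℕ} {x : Form n} (hx : x ∈ sForms n 0)
    (hs : x ∈ signForms n) : ∃ g : Poly n, x = g • topAlternant n ∧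
      ∀ σ : Equiv.Perm (Fin n), MvPolynomial.rename σ g = g := by
  obtain ⟨f, rfl⟩ := exists_eq_tmul_one hx
  obtain ⟨d, hd, hd'⟩ := exists_homogeneous_eq_tmul_one (topAlternant_mem n)
  obtain ⟨c, rfl⟩ := exists_eq_C_mul_vandermonde
    (rename_of_tmul_one_mem (hd' ▸ topAlternant_mem_signForms n)) hd
  have hc : c ≠ 0 := by
    rintro rfl
    exact topAlternant_ne_zero n (by simp [hd'])
  obtain ⟨g, rfl, hg⟩ := exists_eq_vandermonde_mul (rename_of_tmul_one_mem hs)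
  refine ⟨MvPolynomial.C c⁻¹ * g, ?_, fun σ => by rw [map_mul, hg, MvPolynomial.rename_C]⟩
  rw [hd', TensorProduct.smul_tmul', smul_eq_mul]
  congr 1
  have h1 : MvPolynomial.C c⁻¹ * MvPolynomial.C c = (1 : Poly n) := by
    rw [← map_mul, inv_mul_cancel₀ hc, map_one]
  calc vandermonde n * g = (MvPolynomial.C c⁻¹ * MvPolynomial.C c) * (vandermonde n * g) := by
        rw [h1, one_mul]
    _ = _ := by ring

/-- The operators `D_k`, `k ≥ 1`, commute with permutations and lower the degree, below which there
are no nonzero alternating polynomials. -/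
theorem topAlternant_mem_harmonicForms (n : ℕ) : topAlternant n ∈ harmonicForms n := by
  refine harmonic_of_operators (fun k hk => ?_) fun l _ =>
    opDelta_eq_zero (Or.inr zero_lt_one) (topAlternant_mem n)
  have hk := (Finset.mem_Icc.1 hk).1
  by_cases h : ∑ i : Fin n, (i : ℕ) < k
  · exact opD_eq_zero h (topAlternant_mem n)
  obtain ⟨f, hf, hf'⟩ := exists_homogeneous_eq_tmul_one (opD_mem (k := k) (topAlternant_mem n))
  have hs : opD n k (topAlternant n) ∈ signForms n := fun σ => by
    rw [formRep_opD, topAlternant_mem_signForms n σ, map_smul]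
  rw [hf', eq_zero_of_alternating (rename_of_tmul_one_mem (hf' ▸ hs)) hf (by omega),
    TensorProduct.zero_tmul]


/-! ### The number of alternants is at most the expected one -/

/-- Alternating `s`-forms are combinations, with symmetric coefficients, of iterated contractions
of the volume form with invariant vector fields. The coefficients are read off from the functions
obtained by contracting the form with `s` invariant vector fields. -/
theorem exists_expansion {n s : ℕ} {x : Form n} (hx : x ∈ sForms n s) (hs : x ∈ signForms n) :
    ∃ (g : Finset (Fin n) → Poly n) (e : Finset (Fin n) → ℝ),
      (∀ S ∈ Finset.univ.powersetCard s, fieldOp S x = g S • topAlternant n ∧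
        ∀ σ : Equiv.Perm (Fin n), MvPolynomial.rename σ (g S) = g S) ∧
      x = ∑ S ∈ Finset.univ.powersetCard s, e S • g S • fieldOp Sᶜ (volumeForm n) := by
  have h1 : ∀ S : Finset (Fin n), ∃ g : Poly n, S ∈ Finset.univ.powersetCard s →
      (fieldOp S x = g • topAlternant n ∧
        ∀ σ : Equiv.Perm (Fin n), MvPolynomial.rename σ g = g) := by
    intro S
    by_cases hS : S ∈ Finset.univ.powersetCard s
    · rw [Finset.mem_powersetCard] at hS
      obtain ⟨g, hg⟩ := exists_eq_smul_topAlternant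
        (fieldOp_mem_sForms S (s := 0) (x := x) (by rwa [zero_add, hS.2]))
        (fieldOp_mem_signForms S hs)
      exact ⟨g, fun _ => hg⟩
    · exact ⟨0, fun h => absurd h hS⟩
  choose g hg using h1
  choose e he he' using fun S : Finset (Fin n) =>
    fieldOp_fieldOp_of_disjoint (S := S) (T := Sᶜ) disjoint_compl_right
  refine ⟨g, e, hg, ?_⟩
  rw [← sub_eq_zero]
  refine eq_zero_of_fieldOp (s := s) (sub_mem hx (sum_mem fun S hS => ?_)) fun S hS => ?_
  · refine Submodule.smul_mem _ _ (smul_mem_sForms _ (fieldOp_mem_sForms _ ?_))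
    rw [Finset.mem_powersetCard] at hS
    have h2 := S.card_le_univ
    rw [Fintype.card_fin] at h2
    rw [Finset.card_compl, Fintype.card_fin, ← hS.2, Nat.add_sub_cancel' h2]
    exact bidegree_le_sForms _ _ _ (volumeForm_mem n)
  · have hS' : S ∈ Finset.univ.powersetCard s :=
      Finset.mem_powersetCard.2 ⟨Finset.subset_univ S, hS⟩
    rw [map_sub, map_sum, Finset.sum_eq_single S]
    · rw [map_smul, fieldOp_smul, he', Finset.union_compl, (hg S hS').1, smul_comm (g S) (e S),
        smul_smul, he, one_smul]
      exact sub_self _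
    · intro T hT hTS
      rw [Finset.mem_powersetCard] at hT
      rw [map_smul, fieldOp_smul, fieldOp_fieldOp_of_not_disjoint, smul_zero, smul_zero]
      intro hd
      rw [← Finset.subset_compl_iff_disjoint_right, compl_compl] at hd
      exact hTS (Finset.eq_of_subset_of_card_le hd (by rw [hS, hT.2])).symm
    · exact fun h => absurd hS' h

theorem fieldContract_zero (n : ℕ) : fieldContract n 0 = opDelta n 0 := by
  rw [fieldContract, opDelta_eq]
  congr 1
  funext j
  refine LinearMap.ext fun f => ?_
  simp [partialPow]

/-- A harmonic form is annihilated by the contraction with `∑ⱼ ∂ⱼ`. -/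
theorem fieldOp_eq_zero_of_harmonic {n : ℕ} {x : Form n} (hx : x ∈ harmonicForms n)
    {S : Finset (Fin n)} {i : Fin n} (hi : i ∈ S) (h0 : (i : ℕ) = 0) : fieldOp S x = 0 := by
  obtain ⟨e, he, h1⟩ := fieldOp_fieldOp_of_disjoint (S := S.erase i) (T := {i}) (by simp)
  have h2 : S.erase i ∪ {i} = S := by
    rw [Finset.union_comm, ← Finset.insert_eq, Finset.insert_erase hi]
  rw [h2] at h1
  have h3 : fieldOp S x = e • fieldOp (S.erase i) (fieldOp {i} x) := by
    rw [h1, smul_smul, he, one_smul]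
  rw [h3, fieldOp_singleton, h0, fieldContract_zero,
    opDelta_eq_zero_of_harmonic hx, map_zero, smul_zero]

theorem polyInner_eq_zero_of_ne {n a b : ℕ} (hab : a ≠ b) {f g : Poly n} (hf : f.IsHomogeneous a)
    (hg : g.IsHomogeneous b) : polyInner n f g = 0 := by
  rw [f.as_sum, map_sum, LinearMap.sum_apply]
  refine Finset.sum_eq_zero fun α hα => ?_
  have h1 : MvPolynomial.coeff α g = 0 := by
    refine hg.coeff_eq_zero fun h => hab ?_
    rw [← h]
    by_contra h2
    exact MvPolynomial.mem_support_iff.1 hα (hf.coeff_eq_zero (Ne.symm h2))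
  have h2 : MvPolynomial.monomial α (f.coeff α) = f.coeff α • MvPolynomial.monomial α (1 : ℝ) := by
    rw [MvPolynomial.smul_monomial, smul_eq_mul, mul_one]
  rw [h2, map_smul, LinearMap.smul_apply, polyInner_monomial, h1, mul_zero, smul_zero]

theorem smul_eq_tmul_one_mul {n : ℕ} (g : Poly n) (x : Form n) : g • x = (g ⊗ₜ 1) * x := by
  induction x using TensorProduct.induction_on with
  | zero => simp
  | add x y hx hy => rw [smul_add, mul_add, hx, hy]
  | tmul f u => simp [TensorProduct.smul_tmul']

theorem topAlternant_inner_ne_zero (n : ℕ) :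
    formInner n (topAlternant n) (topAlternant n) ≠ 0 := fun h =>
  topAlternant_ne_zero n (formInner_self_eq_zero h)

/-- Modulo the ideal of invariants a symmetric polynomial `g` is its constant term, which is the
coefficient of `g • topAlternant n` along the harmonic form `topAlternant n`. -/
theorem tmul_one_mem_of_inner_eq_zero {n : ℕ} {g : Poly n}
    (hg : ∀ σ : Equiv.Perm (Fin n), MvPolynomial.rename σ g = g)
    (h : formInner n (topAlternant n) (g • topAlternant n) = 0) : g ⊗ₜ 1 ∈ powerIdeal n := by
  set c := MvPolynomial.constantCoeff g with hc
  have h1 : (g - MvPolynomial.C c) ⊗ₜ[ℝ] (1 : Grass n) ∈ powerIdeal n := by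
    refine mem_powerIdeal_of_invariant (fun σ => ?_) ?_
    · rw [formRep_tmul, map_sub, hg, MvPolynomial.rename_C, map_one]
    · rw [augmentation_tmul, map_sub, MvPolynomial.constantCoeff_C, sub_self, zero_mul]
  have h2 : formInner n (topAlternant n) ((g - MvPolynomial.C c) • topAlternant n) = 0 := by
    rw [formInner_comm, smul_eq_tmul_one_mul]
    exact mem_harmonicForms.1 (topAlternant_mem_harmonicForms n) _ (Ideal.mul_mem_right _ _ h1)
  have h3 : (MvPolynomial.C c : Poly n) • topAlternant n = c • topAlternant n := by
    rw [← algebraMap_smul (Poly n) c (topAlternant n)]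
    rfl
  have h4 : g • topAlternant n =
      (g - MvPolynomial.C c) • topAlternant n +
      (MvPolynomial.C c : Poly n) • topAlternant n := by
    rw [← add_smul, sub_add_cancel]
  rw [h4, map_add, h2, h3, map_smul, zero_add, smul_eq_mul, mul_eq_zero] at h
  have h5 := h.resolve_right (topAlternant_inner_ne_zero n)
  rwa [h5, map_zero, sub_zero] at h1

/-- The subsets that index a basis of the alternants of bidegree `(r, s)`. As `i : Fin n` stands
for the exponent `i`, the exponents in `S` lie in `{1, …, n-1}`. -/
def alternantIndex (n r s : ℕ) : Finset (Finset (Fin n)) :=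
  (Finset.univ.powersetCard s).filter
    fun S => (∀ i ∈ S, 0 < (i : ℕ)) ∧ ∑ i ∈ Sᶜ, (i : ℕ) = r

theorem mem_alternantIndex {n r s : ℕ} {S : Finset (Fin n)} : S ∈ alternantIndex n r s ↔
    S.card = s ∧ (∀ i ∈ S, 0 < (i : ℕ)) ∧ ∑ i ∈ Sᶜ, (i : ℕ) = r := by
  rw [alternantIndex, Finset.mem_filter, Finset.mem_powersetCard]
  simp

theorem alternants_le_bidegree (n r s : ℕ) : alternants n r s ≤ bidegree n r s :=
  inf_le_left.trans inf_le_right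

instance finiteDimensional_bidegree (n r s : ℕ) : FiniteDimensional ℝ (bidegree n r s) :=
  Module.Finite.iff_fg.2 (bidegree_fg n r s)

instance finiteDimensional_harmonicPart (n r s : ℕ) : FiniteDimensional ℝ (harmonicPart n r s) :=
  Submodule.finiteDimensional_of_le (inf_le_right : harmonicPart n r s ≤ bidegree n r s)

instance finiteDimensional_alternants (n r s : ℕ) : FiniteDimensional ℝ (alternants n r s) :=
  Submodule.finiteDimensional_of_le (alternants_le_bidegree n r s)

/-- An alternant of bidegree `(r, s)` is determined by the inner products of its contractions with
the fundamental alternant. If they vanish, then the coefficients in its expansion lie in the ideal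
of invariants, so that the form lies in the ideal; being harmonic, it is orthogonal to itself. -/
theorem alternant_eq_zero {n r s : ℕ} {x : Form n} (hx : x ∈ alternants n r s)
    (h : ∀ S ∈ alternantIndex n r s, formInner n (topAlternant n) (fieldOp S x) = 0) : x = 0 := by
  obtain ⟨⟨hH, hB⟩, hs⟩ := hx
  obtain ⟨g, e, hg, hsum⟩ := exists_expansion (bidegree_le_sForms n r s hB) hs
  have key : ∀ S ∈ Finset.univ.powersetCard s, g S ⊗ₜ 1 ∈ powerIdeal n := by
    intro S hS
    obtain ⟨h1, h2⟩ := hg S hS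
    refine tmul_one_mem_of_inner_eq_zero h2 ?_
    rw [← h1]
    rw [Finset.mem_powersetCard] at hS
    by_cases h0 : ∀ i ∈ S, 0 < (i : ℕ)
    · by_cases hr : ∑ i ∈ Sᶜ, (i : ℕ) = r
      · exact h S (mem_alternantIndex.2 ⟨hS.2, h0, hr⟩)
      · -- the degrees of the two functions differ, so they are orthogonal
        obtain ⟨d, hd, hd'⟩ := exists_homogeneous_eq_tmul_one (topAlternant_mem n)
        obtain ⟨f, hf, hf'⟩ := exists_homogeneous_eq_tmul_one
          (fieldOp_mem S (s := 0) (x := x) (by rw [zero_add, hS.2]; exact hB))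
        rw [hd', hf', formInner_tmul, polyInner_eq_zero_of_ne _ hd hf, zero_mul]
        rw [← Finset.sum_add_sum_compl S]
        omega
    · -- contraction with `∑ⱼ ∂ⱼ` is `δ_0`, which annihilates harmonic forms
      push Not at h0
      obtain ⟨i, hi, hi0⟩ := h0
      rw [fieldOp_eq_zero_of_harmonic hH hi (by omega), map_zero]
  refine formInner_self_eq_zero (mem_harmonicForms.1 hH x ?_)
  rw [hsum]
  refine sum_mem fun S hS => ?_
  rw [smul_eq_tmul_one_mul, ← mul_smul_comm]
  exact Ideal.mul_mem_right _ _ (key S hS)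

theorem finrank_alternants_le (n r s : ℕ) :
    Module.finrank ℝ (alternants n r s) ≤ (alternantIndex n r s).card := by
  let φ : alternants n r s →ₗ[ℝ] (alternantIndex n r s → ℝ) :=
    LinearMap.pi fun S => formInner n (topAlternant n) ∘ₗ fieldOp S.1 ∘ₗ (alternants n r s).subtype
  have hφ : Function.Injective φ := by
    intro x y hxy
    refine Subtype.ext (sub_eq_zero.1 (alternant_eq_zero (sub_mem x.2 y.2) fun S hS => ?_))
    rw [map_sub, map_sub, sub_eq_zero]
    exact congrFun hxy ⟨S, hS⟩
  have := LinearMap.finrank_le_finrank_of_injective hφ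
  simpa using this

/-! ### Harmonic alternants obtained from the fundamental one -/

/-- The composition of the operators `d_l` indexed by `S`. -/
def opdOp {n : ℕ} (S : Finset (Fin n)) : Module.End ℝ (Form n) := opdHom n (grassBasis n S)

theorem opdOp_empty {n : ℕ} (x : Form n) : opdOp ∅ x = x := by
  rw [opdOp, grassBasis_empty, map_one]
  rfl

theorem opdOp_insert {n : ℕ} {i : Fin n} {S : Finset (Fin n)} (hi : i ∉ S) :
    ∃ e : ℝ, e * e = 1 ∧ ∀ x, opdOp (insert i S) x = e • opd n i (opdOp S x) :=
  grassHom_insert _ hi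

theorem opdOp_opdOp_of_not_disjoint {n : ℕ} {S T : Finset (Fin n)} (h : ¬ Disjoint S T)
    (x : Form n) : opdOp S (opdOp T x) = 0 := by
  rw [opdOp, opdOp, ← Module.End.mul_apply, ← map_mul, grassBasis_mul_of_not_disjoint h,
    map_zero, LinearMap.zero_apply]

theorem opdOp_opdOp_of_disjoint {n : ℕ} {S T : Finset (Fin n)} (h : Disjoint S T) :
    ∃ e : ℝ, e * e = 1 ∧ ∀ x, opdOp S (opdOp T x) = e • opdOp (S ∪ T) x := by
  obtain ⟨e, he, h1⟩ := grassBasis_mul_of_disjoint h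
  refine ⟨e, he, fun x => ?_⟩
  rw [opdOp, opdOp, ← Module.End.mul_apply, ← map_mul, h1, map_smul]
  rfl

/-- The condition `0 < l` is needed: `δ_0 d_0 + d_0 δ_0 = D_0` is multiplication by `n`. -/
theorem opd_mem_harmonicForms {n l : ℕ} (hl : 0 < l) {x : Form n} (hx : x ∈ harmonicForms n) :
    opd n l x ∈ harmonicForms n := by
  refine harmonic_of_operators (fun k hk => ?_) fun k _ => ?_
  · have := LinearMap.congr_fun (opD_comm_opd n k l) x
    rw [Module.End.mul_apply, Module.End.mul_apply,
      opD_eq_zero_of_harmonic (Finset.mem_Icc.1 hk).1 hx, map_zero] at this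
    exact this
  · have := LinearMap.congr_fun (opDelta_opd n k l) x
    rw [LinearMap.add_apply, Module.End.mul_apply, Module.End.mul_apply,
      opDelta_eq_zero_of_harmonic hx, map_zero, add_zero,
      opD_eq_zero_of_harmonic (by omega) hx] at this
    exact this

theorem opdOp_mem_harmonicForms {n : ℕ} {S : Finset (Fin n)} (hS : ∀ i ∈ S, 0 < (i : ℕ))
    {x : Form n} (hx : x ∈ harmonicForms n) : opdOp S x ∈ harmonicForms n := by
  induction S using Finset.induction with
  | empty => rwa [opdOp_empty]
  | insert i S hi ih =>
    obtain ⟨e, -, he⟩ := opdOp_insert hi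
    rw [he]
    exact Submodule.smul_mem _ _ (opd_mem_harmonicForms (hS i (Finset.mem_insert_self i S))
      (ih fun j hj => hS j (Finset.mem_insert_of_mem hj)))

theorem opdOp_mem_signForms {n : ℕ} (S : Finset (Fin n)) {x : Form n} (hx : x ∈ signForms n) :
    opdOp S x ∈ signForms n := by
  induction S using Finset.induction with
  | empty => rwa [opdOp_empty]
  | insert i S hi ih =>
    obtain ⟨e, -, he⟩ := opdOp_insert hi
    rw [he]
    refine Submodule.smul_mem _ _ fun σ => ?_
    rw [formRep_opd, ih σ, map_smul]

theorem opdOp_mem {n r s : ℕ} (S : Finset (Fin n)) {x : Form n} (hx : x ∈ bidegree n r s) :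
    opdOp S x ∈ bidegree n (r - ∑ i ∈ S, (i : ℕ)) (s + S.card) := by
  induction S using Finset.induction with
  | empty => rw [opdOp_empty]; simpa using hx
  | insert i S hi ih =>
    obtain ⟨e, -, he⟩ := opdOp_insert hi
    rw [he, Finset.sum_insert hi, Finset.card_insert_of_notMem hi, add_comm (i : ℕ), ← Nat.sub_sub,
      ← add_assoc]
    exact Submodule.smul_mem _ _ (opd_mem ih)

theorem formInner_opdOp {n : ℕ} (S : Finset (Fin n)) :
    ∃ e : ℝ, e * e = 1 ∧ ∀ x y, formInner n (opdOp S x) y = e * formInner n x (fieldOp S y) := by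
  induction S using Finset.induction with
  | empty => exact ⟨1, one_mul 1, fun x y => by rw [opdOp_empty, fieldOp_empty, one_mul]⟩
  | insert i S hi ih =>
    obtain ⟨a, ha, ha'⟩ := opdOp_insert hi
    obtain ⟨b, hb, hb'⟩ := ih
    obtain ⟨c, hc, hc'⟩ := fieldOp_fieldOp_of_disjoint (S := S) (T := {i}) (by simpa using hi)
    refine ⟨a * b * c, ?_, fun x y => ?_⟩
    · calc a * b * c * (a * b * c) = (a * a) * (b * b) * (c * c) := by ring
        _ = 1 := by rw [ha, hb, hc]; norm_num
    · rw [ha', map_smul, LinearMap.smul_apply, formInner_opd, hb', ← fieldOp_singleton, hc',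
        map_smul, Finset.union_comm, ← Finset.insert_eq]
      simp only [smul_eq_mul]
      ring

/-- The operators `d_l` are adjoint to the contractions that produce the fundamental alternant from
the volume form. -/
theorem opdOp_univ_topAlternant_ne_zero (n : ℕ) : opdOp Finset.univ (topAlternant n) ≠ 0 := by
  intro h
  obtain ⟨e, he, h1⟩ := formInner_opdOp (Finset.univ : Finset (Fin n))
  have h2 := h1 (topAlternant n) (volumeForm n)
  rw [h, map_zero, LinearMap.zero_apply, eq_comm, mul_eq_zero] at h2
  rcases h2 with h2 | h2
  · rw [h2] at he
    simp at he
  · exact topAlternant_inner_ne_zero n h2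

theorem opdOp_topAlternant_mem {n r s : ℕ} {S : Finset (Fin n)} (hS : S ∈ alternantIndex n r s) :
    opdOp S (topAlternant n) ∈ alternants n r s := by
  rw [mem_alternantIndex] at hS
  refine ⟨⟨opdOp_mem_harmonicForms hS.2.1 (topAlternant_mem_harmonicForms n), ?_⟩,
    opdOp_mem_signForms S (topAlternant_mem_signForms n)⟩
  have := opdOp_mem S (topAlternant_mem n)
  rw [← Finset.sum_add_sum_compl S, Nat.add_sub_cancel_left, hS.2.2, hS.1, zero_add] at this
  exact this

theorem card_le_finrank_alternants (n r s : ℕ) :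
    (alternantIndex n r s).card ≤ Module.finrank ℝ (alternants n r s) := by
  let ψ : (alternantIndex n r s → ℝ) →ₗ[ℝ] alternants n r s :=
    Fintype.linearCombination ℝ fun S : alternantIndex n r s =>
      (⟨opdOp S.1 (topAlternant n), opdOp_topAlternant_mem S.2⟩ : alternants n r s)
  have hψ : Function.Injective ψ := by
    refine (injective_iff_map_eq_zero ψ).2 fun c hc => funext fun S => ?_
    rw [Fintype.linearCombination_apply] at hc
    -- applying the operator indexed by the complement of `S` isolates the coefficient of `S`
    have h1 := congrArg (fun x : alternants n r s => opdOp (S.1)ᶜ (x : Form n)) hc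
    simp only [Submodule.coe_sum, Submodule.coe_smul, map_sum, map_smul, ZeroMemClass.coe_zero,
      map_zero] at h1
    rw [Finset.sum_eq_single S] at h1
    · obtain ⟨e, he, h2⟩ := opdOp_opdOp_of_disjoint (S := (S.1)ᶜ) (T := S.1) disjoint_compl_left
      rw [h2, Finset.union_comm, Finset.union_compl, smul_smul, smul_eq_zero] at h1
      have h3 := h1.resolve_right (opdOp_univ_topAlternant_ne_zero n)
      rcases mul_eq_zero.1 h3 with h4 | h4
      · exact h4
      · rw [h4] at he
        simp at he
    · intro T _ hTS
      rw [opdOp_opdOp_of_not_disjoint, smul_zero]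
      intro hd
      rw [disjoint_comm, ← Finset.subset_compl_iff_disjoint_right, compl_compl] at hd
      refine hTS (Subtype.ext (Finset.eq_of_subset_of_card_le hd ?_))
      rw [(mem_alternantIndex.1 T.2).1, (mem_alternantIndex.1 S.2).1]
    · exact fun h => absurd (Finset.mem_univ S) h
  have := LinearMap.finrank_le_finrank_of_injective hψ
  simpa using this

theorem finrank_alternants (n r s : ℕ) :
    Module.finrank ℝ (alternants n r s) = (alternantIndex n r s).card :=
  le_antisymm (finrank_alternants_le n r s) (card_le_finrank_alternants n r s)

/-! ### The generating function -/

/-- Expanding the product, the set `S` collects the factors `q^j + t` from which `t` is chosen. -/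
theorem card_alternantIndex (n : ℕ) (d : Fin 2 →₀ ℕ) :
    ((alternantIndex n (d 0) (d 1)).card : ℝ) = MvPowerSeries.coeff d
      (∏ j ∈ Finset.Ico 1 n, (MvPowerSeries.X (0 : Fin 2) ^ j + MvPowerSeries.X (1 : Fin 2)) :
        MvPowerSeries (Fin 2) ℝ) := by
  set P : Finset (Fin n) := Finset.univ.filter fun i => 0 < (i : ℕ) with hP
  have h1 : (∏ j ∈ Finset.Ico 1 n, (MvPowerSeries.X (0 : Fin 2) ^ j +
      MvPowerSeries.X (1 : Fin 2)) : MvPowerSeries (Fin 2) ℝ) =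
      ∏ i ∈ P, (MvPowerSeries.X (1 : Fin 2) + MvPowerSeries.X (0 : Fin 2) ^ (i : ℕ) :
        MvPowerSeries (Fin 2) ℝ) := by
    symm
    refine Finset.prod_nbij (fun i : Fin n => (i : ℕ)) ?_ ?_ ?_ ?_
    · intro i hi
      rw [hP, Finset.mem_filter] at hi
      exact Finset.mem_Ico.2 ⟨hi.2, i.2⟩
    · exact Fin.val_injective.injOn
    · intro j hj
      rw [Finset.mem_coe, Finset.mem_Ico] at hj
      refine ⟨⟨j, hj.2⟩, ?_, rfl⟩
      rw [hP, Finset.mem_coe, Finset.mem_filter]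
      exact ⟨Finset.mem_univ _, hj.1⟩
    · exact fun i _ => add_comm _ _
  have h2 : ∀ S ∈ P.powerset, ∑ i ∈ P \ S, (i : ℕ) = ∑ i ∈ Sᶜ, (i : ℕ) := by
    intro S _
    refine Finset.sum_subset (fun i hi => ?_) fun i hi hi' => ?_
    · rw [Finset.mem_sdiff] at hi
      exact Finset.mem_compl.2 hi.2
    · rw [Finset.mem_compl] at hi
      rw [Finset.mem_sdiff, hP, Finset.mem_filter] at hi'
      by_contra h
      exact hi' ⟨⟨Finset.mem_univ i, Nat.pos_of_ne_zero h⟩, hi⟩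
  have h3 : ∀ a b : ℕ, MvPowerSeries.coeff d
      (MvPowerSeries.X (1 : Fin 2) ^ a * MvPowerSeries.X (0 : Fin 2) ^ b :
        MvPowerSeries (Fin 2) ℝ) = if a = d 1 ∧ b = d 0 then 1 else 0 := by
    intro a b
    rw [MvPowerSeries.X_pow_eq, MvPowerSeries.X_pow_eq, MvPowerSeries.monomial_mul_monomial,
      MvPowerSeries.coeff_monomial, one_mul]
    refine if_congr ?_ rfl rfl
    constructor
    · rintro rfl
      simp
    · rintro ⟨ha, hb⟩
      ext i
      fin_cases i <;> simp [ha, hb]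
  rw [h1, Finset.prod_add, map_sum]
  simp only [Finset.prod_const, Finset.prod_pow_eq_pow_sum, h3]
  rw [Finset.sum_boole]
  congr 2
  ext S
  rw [mem_alternantIndex, Finset.mem_filter]
  constructor
  · rintro ⟨ha, hb, hc⟩
    have hS : S ∈ P.powerset := Finset.mem_powerset.2 fun i hi => by simpa [hP] using hb i hi
    exact ⟨hS, ha, by rw [h2 S hS, hc]⟩
  · rintro ⟨hS, ha, hc⟩
    refine ⟨ha, fun i hi => ?_, by rw [← h2 S hS, hc]⟩
    simpa [hP] using Finset.mem_powerset.1 hS hi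

theorem alternantSeries_eq (n : ℕ) : alternantSeries n =
    ∏ j ∈ Finset.Ico 1 n, (MvPowerSeries.X (0 : Fin 2) ^ j + MvPowerSeries.X (1 : Fin 2)) := by
  ext d
  rw [← card_alternantIndex, ← finrank_alternants]
  rfl

/-! ### Multiplicities of the sign character -/

/-- The projection of `H_{r,s}` onto its alternants. -/
def alternantProj (n r s : ℕ) : Module.End ℝ (harmonicPart n r s) :=
  (1 / (n.factorial : ℝ)) • ∑ σ, sgn n σ • harmonicRep n r s σ

theorem coe_harmonicRep {n r s : ℕ} (σ : Equiv.Perm (Fin n)) (x : harmonicPart n r s) :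
    (harmonicRep n r s σ x : Form n) = formRep n σ x := rfl

theorem sgn_mul_self {n : ℕ} (σ : Equiv.Perm (Fin n)) : sgn n σ * sgn n σ = 1 := by
  rw [sgn]
  norm_cast
  simp

theorem isProj_alternantProj (n r s : ℕ) :
    LinearMap.IsProj ((signForms n).comap (harmonicPart n r s).subtype) (alternantProj n r s) where
  map_mem x τ := by
    rw [alternantProj, LinearMap.smul_apply, LinearMap.sum_apply, map_smul, map_sum, map_smul,
      map_sum, smul_comm]
    congr 1
    rw [Finset.smul_sum, ← Equiv.sum_comp (Equiv.mulLeft τ) (fun σ =>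
      ((Equiv.Perm.sign τ : ℤ) : ℝ) • (harmonicPart n r s).subtype
        ((sgn n σ • harmonicRep n r s σ) x))]
    refine Finset.sum_congr rfl fun σ _ => ?_
    simp only [LinearMap.smul_apply, map_smul, Submodule.subtype_apply, coe_harmonicRep,
      Equiv.coe_mulLeft, smul_smul]
    have h : ((Equiv.Perm.sign τ : ℤ) : ℝ) * sgn n (τ * σ) = sgn n σ := by
      have : sgn n (τ * σ) = sgn n τ * sgn n σ := by simp [sgn]
      rw [this, ← mul_assoc]
      exact (congrArg (· * sgn n σ) (sgn_mul_self τ)).trans (one_mul _)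
    rw [h, map_mul]
    rfl
  map_id x hx := by
    have h : ∀ σ, harmonicRep n r s σ x = sgn n σ • x := fun σ => Subtype.ext (hx σ)
    rw [alternantProj, LinearMap.smul_apply, LinearMap.sum_apply]
    simp only [LinearMap.smul_apply, h, smul_smul, sgn_mul_self, one_smul]
    rw [Finset.sum_const, Finset.card_univ, Fintype.card_perm, Fintype.card_fin,
      ← Nat.cast_smul_eq_nsmul ℝ, smul_smul, one_div,
      inv_mul_cancel₀ (by exact_mod_cast n.factorial_ne_zero), one_smul]

/-- The trace of a projection is the dimension of its image. -/
theorem trace_isProj {V : Type*} [AddCommGroup V] [Module ℝ V] [FiniteDimensional ℝ V]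
    {p : Submodule ℝ V} {f : Module.End ℝ V} (h : LinearMap.IsProj p f) :
    LinearMap.trace ℝ V f = Module.finrank ℝ p :=
  h.trace

theorem classInner_harmonicChar (n r s : ℕ) :
    classInner n (harmonicChar n r s) (sgn n) = Module.finrank ℝ (alternants n r s) := by
  have h1 : classInner n (harmonicChar n r s) (sgn n) =
      LinearMap.trace ℝ _ (alternantProj n r s) := by
    rw [alternantProj, map_smul, map_sum, classInner, smul_eq_mul]
    congr 1
    refine Finset.sum_congr rfl fun σ _ => ?_
    rw [map_smul, smul_eq_mul, mul_comm]
    rfl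
  rw [h1]
  -- the module structures have to be found by unification: those synthesized for submodules of
  -- `Form n` are equal to them only after unfolding
  have h2 := @trace_isProj (harmonicPart n r s) _ _ _
    ((signForms n).comap (harmonicPart n r s).subtype) (alternantProj n r s)
    (isProj_alternantProj n r s)
  refine h2.trans ?_
  congr 1
  let φ : (signForms n).comap (harmonicPart n r s).subtype →ₗ[ℝ] alternants n r s :=
    ((harmonicPart n r s).subtype ∘ₗ Submodule.subtype _).codRestrict _
      fun x => ⟨x.1.2, x.2⟩
  refine (LinearEquiv.ofBijective φ ⟨fun x y h => ?_, fun y => ?_⟩).finrank_eq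
  · exact Subtype.ext (Subtype.ext (congrArg (fun z : alternants n r s => (z : Form n)) h))
  · exact ⟨⟨⟨y.1, y.2.1⟩, y.2.2⟩, rfl⟩

theorem characterSeries_eq (n : ℕ) : characterSeries n = alternantSeries n := by
  funext d
  exact classInner_harmonicChar n (d 0) (d 1)

end PolyForms

end

open PolyForms in
theorem theorem13 (n : ℕ) :
    -- the orthogonal complement is the direct sum of its bihomogeneous parts `H_{r,s}`,
    (iSupIndep (fun p : ℕ × ℕ => harmonicPart n p.1 p.2) ∧
      ⨆ p : ℕ × ℕ, harmonicPart n p.1 p.2 = harmonicForms n) ∧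
    -- which are finite-dimensional
    (∀ r s : ℕ, FiniteDimensional ℝ (harmonicPart n r s)) ∧
    -- and are cut out of the forms of bidegree `(r, s)` by the operators `D_k` and `δ_l`;
    (∀ (r s : ℕ) (ω : Form n), ω ∈ harmonicPart n r s ↔
      ω ∈ bidegree n r s ∧ (∀ k ∈ Finset.Icc 1 n, opD n k ω = 0) ∧
        ∀ l ∈ Finset.range n, opDelta n l ω = 0) ∧
    -- the Hilbert series of the alternants,
    alternantSeries n =
      ∏ j ∈ Finset.Ico 1 n, (MvPowerSeries.X (0 : Fin 2) ^ j + MvPowerSeries.X (1 : Fin 2)) ∧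
    -- also written with the multiplicities of the sign character
    characterSeries n =
      ∏ j ∈ Finset.Ico 1 n, (MvPowerSeries.X (0 : Fin 2) ^ j + MvPowerSeries.X (1 : Fin 2)) := by
  refine ⟨⟨(iSupIndep_bidegree n).mono fun p => inf_le_right, iSup_harmonicPart n⟩,
    fun r s => inferInstance, fun r s ω => ?_, alternantSeries_eq n,
    (characterSeries_eq n).trans (alternantSeries_eq n)⟩
  constructor
  · exact fun h => ⟨h.2, fun k hk => opD_eq_zero_of_harmonic (Finset.mem_Icc.1 hk).1 h.1,
      fun l _ => opDelta_eq_zero_of_harmonic h.1⟩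
  · exact fun h => ⟨harmonic_of_operators h.2.1 h.2.2, h.1⟩
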